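/- Let $L$ be a finite-dimensional solvable Lie algebra over a field $F$ (of any characteristic). For a finite-dimensional Lie algebra $K$ over $F$, let $\phi(K)$ (the Frattini subalgebra) be the intersection of the maximal subalgebras of $K$. Call $K$ \emph{complemented} if for every subalgebra $S$ of $K$ there is a subalgebra $T$ of $K$ with $S\cap T=0$ and $\langle S,T\rangle=K$; \emph{elementary} if $\phi(S)=0$ for every subalgebra $S$ of $K$; \emph{completely solvable} if $K^2=[K,K]$ is nilpotent. Let $\pi(K)$ (the prefrattini residual) be the intersection of all ideals $I$ of $K$ such that $K/I$ is solvable and complemented, let $E(K)$ (the elementary commutator) be the intersection of all ideals $I$ of $K$ such that $K/I$ is solvable and elementary, and let $K^\infty$ (the nilpotent residual) be the intersection of all ideals $I$ of $K$ such that $K/I$ is nilpotent. A chief series of $L$ is a chain of ideals $0=A_0\subset A_1\subset\dots\subset A_n=L$ of $L$ that cannot be refined; the factor $A_i/A_{i-1}$ is \emph{Frattini} if $A_i/A_{i-1}\subseteq\phi(L/A_{i-1})$. A \emph{prefrattini subalgebra} of $L$ is a subalgebra of the form $B=\bigcap_{i\in\mathcal I}M_i$, where, for some chief series, $\mathcal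 I$ is the set of $i$ for which $A_i/A_{i-1}$ is not Frattini and each $M_i$ is a maximal subalgebra of $L$ with $A_{i-1}\subseteq M_i$ and $A_i\not\subseteq M_i$. Then: (i) $\phi(L)\subseteq\pi(L)\subseteq E(L)$, and if $L$ is completely solvable then $\phi(L)=\pi(L)=E(L)$; (ii) if $A$ is an ideal of $L$ then $\pi(L/A)=(\pi(L)+A)/A$; in particular, $\phi(L)$ being an ideal of $L$, $\pi(L/\phi(L))=\pi(L)/\phi(L)$; (iii) $\pi(L)$ is nilpotent if and only if $\pi(L)=\phi(L)$; (iv) if $B$ is a prefrattini subalgebra of $L$ then $\pi(L)=B+\pi(L)^\infty$. -/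

import Mathlib

namespace SolvLie

/-- The Frattini subalgebra: the intersection of the maximal (proper) subalgebras. -/
def frattini (F L : Type*) [Field F] [LieRing L] [LieAlgebra F L] : LieSubalgebra F L :=
  sInf {M : LieSubalgebra F L | IsCoatom M}

/-- Every subalgebra `S` has a subalgebra `T` with `S ∩ T = 0` and `⟨S, T⟩ = L`. -/
def IsComplemented (F L : Type*) [Field F] [LieRing L] [LieAlgebra F L] : Prop :=
  ∀ S : LieSubalgebra F L, ∃ T : LieSubalgebra F L, S ⊓ T = ⊥ ∧ S ⊔ T = ⊤

/-- Every subalgebra has trivial Frattini subalgebra. -/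
def IsElementary (F L : Type*) [Field F] [LieRing L] [LieAlgebra F L] : Prop :=
  ∀ S : LieSubalgebra F L, frattini F S = ⊥

/-- `L² = [L, L]` is nilpotent. -/
def IsCompletelySolvable (F L : Type*) [Field F] [LieRing L] [LieAlgebra F L] : Prop :=
  LieRing.IsNilpotent (LieAlgebra.derivedSeries F L 1)

/-- The prefrattini residual `π(L)`: the intersection of the ideals whose quotient is a solvable
complemented Lie algebra. -/
def prefrattiniResidual (F L : Type*) [Field F] [LieRing L] [LieAlgebra F L] : LieIdeal F L :=
  sInf {I : LieIdeal F L | LieAlgebra.IsSolvable (L ⧸ I) ∧ IsComplemented F (L ⧸ I)}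

/-- The elementary commutator `E(L)`: the residual of the class of solvable elementary Lie
algebras, as the intersection of the ideals whose quotient lies in that class. -/
def elementaryCommutator (F L : Type*) [Field F] [LieRing L] [LieAlgebra F L] : LieIdeal F L :=
  sInf {I : LieIdeal F L | LieAlgebra.IsSolvable (L ⧸ I) ∧ IsElementary F (L ⧸ I)}

/-- The nilpotent residual `L^∞`: the intersection of the ideals whose quotient is a nilpotent
Lie algebra. -/
def nilpotentResidual (F L : Type*) [Field F] [LieRing L] [LieAlgebra F L] : LieIdeal F L :=
  sInf {I : LieIdeal F L | LieRing.IsNilpotent (L ⧸ I)}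

/-- A chief series `0 = A₀ ⊂ A₁ ⊂ ⋯ ⊂ Aₙ = L`: a chain of ideals of `L` with no ideal of `L`
strictly between consecutive terms. -/
structure ChiefSeries (F L : Type*) [Field F] [LieRing L] [LieAlgebra F L] where
  /-- The number of chief factors. -/
  n : ℕ
  /-- The terms. -/
  A : Fin (n + 1) → LieIdeal F L
  bot : A 0 = ⊥
  top : A (Fin.last n) = ⊤
  step : ∀ i : Fin n, A i.castSucc ⋖ A i.succ

/-- The chief factor `A (i+1) / A i` is Frattini: it is contained in `φ(L / A i)`. -/
def ChiefSeries.IsFrattini {F L : Type*} [Field F] [LieRing L] [LieAlgebra F L]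
    (s : ChiefSeries F L) (i : Fin s.n) : Prop :=
  (s.A i.succ).toSubmodule.map (LieSubmodule.Quotient.mk' (s.A i.castSucc) :
      L →ₗ[F] L ⧸ s.A i.castSucc) ≤
    (frattini F (L ⧸ s.A i.castSucc)).toSubmodule

/-- `B` is a prefrattini subalgebra: for some chief series, it is the intersection of a choice,
for each non-Frattini chief factor `A (i+1) / A i`, of a maximal subalgebra of `L` that
contains `A i` and does not contain `A (i+1)`. -/
def IsPrefrattini {F L : Type*} [Field F] [LieRing L] [LieAlgebra F L]
    (B : LieSubalgebra F L) : Prop :=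
  ∃ (s : ChiefSeries F L) (M : Fin s.n → LieSubalgebra F L),
    (∀ i, ¬ s.IsFrattini i →
      IsCoatom (M i) ∧ (s.A i.castSucc).toLieSubalgebra ≤ M i ∧
        ¬ (s.A i.succ).toLieSubalgebra ≤ M i) ∧
    B = ⨅ (i : Fin s.n) (_ : ¬ s.IsFrattini i), M i

end SolvLie

/-! The engine is a descent, `IsComplementedOver.of_covBy`: if `L/A` is complemented and a maximal
subalgebra contains `J` but not `A`, where `A/J` is a chief factor, then `L/J` is complemented.
Hence ideals with complemented quotient are closed under intersection, and `π(L)` is the least of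
them. Since complementation also passes to quotients, (ii) follows; since a complemented algebra has
zero Frattini subalgebra, `φ(L) ⊆ π(L)`.

Leastness then pays off: if `N ⊇ π(L)` and a maximal `M` meets `N` in an ideal `D` covered by `N`,
the descent gives `π(L) ⊆ D ⊆ M`. With `N = π(L)` this is absurd, so a maximal subalgebra containing
a lower central term of `π(L)` contains `π(L)`; this is half of (iii), and Engel's theorem with
Fitting's decomposition gives the other half. With `N = π(L) + A` it shows that `M` contains `π(L)`
when `M` avoids a chief factor `A/J` centralised by `π(L)`. A chief factor not so centralised is
covered by every lower central term of `π(L)`. This dichotomy, used in a downward induction along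
the chief series, proves (iv).

Induction on dimension shows that solvable elementary algebras are complemented, so `π(L) ⊆ E(L)`.
If `L²` is nilpotent, then `L/φ(L)` has zero Frattini subalgebra and abelian derived algebra, and
`isElementary_of_frattini_eq_bot` makes it elementary, so `E(L) ⊆ φ(L)`. -/

namespace SolvLie

/-! ### Dedekind laws, chief factors and the descent of complementation -/

section Basic

variable {F L : Type*} [Field F] [LieRing L] [LieAlgebra F L]

theorem mem_sup_ideal {S : LieSubalgebra F L} {A : LieIdeal F L} {x : L} :
    x ∈ S ⊔ A.toLieSubalgebra ↔ ∃ s ∈ S, ∃ a ∈ A, s + a = x := by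
  constructor
  · let T : LieSubalgebra F L :=
      { S.toSubmodule ⊔ A.toSubmodule with
        lie_mem' := by
          intro x y hx hy
          simp only [AddSubsemigroup.mem_carrier, AddSubmonoid.mem_toSubsemigroup,
            Submodule.mem_toAddSubmonoid, Submodule.mem_sup] at hx hy ⊢
          obtain ⟨s, hs, a, ha, rfl⟩ := hx
          obtain ⟨t, ht, b, hb, rfl⟩ := hy
          refine ⟨⁅s, t⁆, S.lie_mem hs ht, ⁅s + a, b⁆ + ⁅a, t⁆,
            A.add_mem (lie_mem_right F L A _ _ hb) (lie_mem_left F L A _ _ ha), ?_⟩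
          simp only [add_lie, lie_add]
          abel }
    have hT : S ⊔ A.toLieSubalgebra ≤ T := by
      refine sup_le ?_ ?_
      · intro y hy
        exact (le_sup_left : S.toSubmodule ≤ S.toSubmodule ⊔ A.toSubmodule) hy
      · intro y hy
        exact (le_sup_right : A.toSubmodule ≤ S.toSubmodule ⊔ A.toSubmodule) hy
    intro hx
    exact Submodule.mem_sup.1 (hT hx)
  · rintro ⟨s, hs, a, ha, rfl⟩
    exact add_mem ((le_sup_left : S ≤ S ⊔ A.toLieSubalgebra) hs)
      ((le_sup_right : A.toLieSubalgebra ≤ S ⊔ A.toLieSubalgebra) ha)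

theorem wellFoundedLT_lieIdeal [FiniteDimensional F L] : WellFoundedLT (LieIdeal F L) :=
  LieSubmodule.wellFoundedLT_of_isArtinian F L L

theorem toLieSubalgebra_sup (A B : LieIdeal F L) :
    (A ⊔ B).toLieSubalgebra = A.toLieSubalgebra ⊔ B.toLieSubalgebra := by
  ext x
  rw [mem_sup_ideal, LieIdeal.mem_toLieSubalgebra, LieSubmodule.mem_sup]
  rfl

/-- Dedekind's law for subalgebras, one of which is an ideal. -/
theorem sup_ideal_inf_le {S T : LieSubalgebra F L} {A : LieIdeal F L} (h : S ≤ T) :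
    (S ⊔ A.toLieSubalgebra) ⊓ T ≤ S ⊔ (A.toLieSubalgebra ⊓ T) := by
  rintro x ⟨hx, hxT⟩
  obtain ⟨s, hs, a, ha, rfl⟩ := mem_sup_ideal.1 hx
  have haT : a ∈ T := by simpa using sub_mem (show s + a ∈ T from hxT) (h hs)
  exact add_mem ((le_sup_left : S ≤ _) hs)
    ((le_sup_right : A.toLieSubalgebra ⊓ T ≤ S ⊔ _) ⟨ha, haT⟩)

/-- Dedekind's law for a subalgebra that contains an ideal. -/
theorem inf_sup_ideal_le {S T : LieSubalgebra F L} {A : LieIdeal F L}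
    (h : A.toLieSubalgebra ≤ T) :
    (S ⊔ A.toLieSubalgebra) ⊓ T ≤ (S ⊓ T) ⊔ A.toLieSubalgebra := by
  rintro x ⟨hx, hxT⟩
  obtain ⟨s, hs, a, ha, rfl⟩ := mem_sup_ideal.1 hx
  have hsT : s ∈ T := by simpa using sub_mem (show s + a ∈ T from hxT) (h ha)
  exact mem_sup_ideal.2 ⟨s, ⟨hs, hsT⟩, a, ha, rfl⟩

theorem sup_ideal_eq_top {M : LieSubalgebra F L} (hM : IsCoatom M) {A : LieIdeal F L}
    (h : ¬ A.toLieSubalgebra ≤ M) : M ⊔ A.toLieSubalgebra = ⊤ :=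
  hM.2 _ (left_lt_sup.2 h)

/-- Since `L = M + A` and `M` normalises `M ∩ N`, only the action of `A` has to be checked. -/
theorem exists_ideal_eq_inf {M : LieSubalgebra F L} {A N : LieIdeal F L}
    (htop : M ⊔ A.toLieSubalgebra = ⊤) (h : ∀ a ∈ A, ∀ y ∈ N, y ∈ M → ⁅a, y⁆ ∈ M) :
    ∃ D : LieIdeal F L, D.toLieSubalgebra = M ⊓ N.toLieSubalgebra := by
  let D : LieIdeal F L :=
    { M.toSubmodule ⊓ N.toSubmodule with
      lie_mem := by
        rintro x y ⟨hyM, hyN⟩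
        obtain ⟨m, hm, a, ha, rfl⟩ := mem_sup_ideal.1 (htop ▸ LieSubalgebra.mem_top (R := F) x)
        refine ⟨?_, lie_mem_right F L N _ _ hyN⟩
        rw [add_lie]
        exact add_mem (M.lie_mem hm hyM) (h a ha y hyN hyM) }
  exact ⟨D, rfl⟩

theorem mem_iff_of_toLieSubalgebra_eq_inf {D N : LieIdeal F L} {M : LieSubalgebra F L}
    (h : D.toLieSubalgebra = M ⊓ N.toLieSubalgebra) {x : L} : x ∈ D ↔ x ∈ M ∧ x ∈ N := by
  rw [← LieIdeal.mem_toLieSubalgebra, h]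
  rfl

/-- If `M` is maximal, `N` is an ideal and `A ≤ N` is an ideal not contained in `M` such that
`[A, M ∩ N] ≤ M`, then `M ∩ N` is an ideal covered by `N`. -/
theorem exists_ideal_eq_inf_covBy {M : LieSubalgebra F L} (hM : IsCoatom M) {A N : LieIdeal F L}
    (hA : ¬ A.toLieSubalgebra ≤ M) (hAN : A ≤ N)
    (h : ∀ a ∈ A, ∀ y ∈ N, y ∈ M → ⁅a, y⁆ ∈ M) :
    ∃ D : LieIdeal F L, D.toLieSubalgebra = M ⊓ N.toLieSubalgebra ∧ D ⋖ N := by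
  obtain ⟨D, hD'⟩ := exists_ideal_eq_inf (sup_ideal_eq_top hM hA) h
  have hD : ∀ x, x ∈ D ↔ x ∈ M ∧ x ∈ N := fun x => mem_iff_of_toLieSubalgebra_eq_inf hD'
  refine ⟨D, hD', ⟨?_, ?_⟩, ?_⟩
  · exact fun x hx => ((hD x).1 hx).2
  · exact fun hND => hA fun x hx => ((hD x).1 (hND (hAN hx))).1
  · intro X hDX hXN
    have hXM : ¬ X.toLieSubalgebra ≤ M :=
      fun hXM => hDX.2 fun x hx => (hD x).2 ⟨hXM hx, hXN.1 hx⟩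
    have hX := sup_ideal_eq_top hM hXM
    refine hXN.2 fun y hy => ?_
    obtain ⟨m, hm, x, hx, rfl⟩ := mem_sup_ideal.1 (hX ▸ LieSubalgebra.mem_top (R := F) y)
    have hmN : m ∈ N := by simpa using sub_mem hy (hXN.1 hx)
    exact add_mem (hDX.1 ((hD m).2 ⟨hm, hmN⟩)) hx

theorem lie_sup_self_le (J D : LieIdeal F L) : ⁅J ⊔ D, J ⊔ D⁆ ≤ J ⊔ ⁅D, D⁆ := by
  rw [LieSubmodule.sup_lie]
  refine sup_le ((LieSubmodule.lie_le_left J (J ⊔ D)).trans le_sup_left) ?_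
  rw [LieSubmodule.lie_sup]
  exact sup_le_sup_right (LieSubmodule.lie_le_right J D) _

/-- Chief factors of a solvable Lie algebra are abelian. -/
theorem lie_self_le_of_covBy [LieAlgebra.IsSolvable L] {J A : LieIdeal F L} (h : J ⋖ A) :
    ⁅A, A⁆ ≤ J := by
  rcases h.eq_or_eq (c := J ⊔ ⁅A, A⁆) le_sup_left
    (sup_le h.le (LieSubmodule.lie_le_right _ _)) with h' | h'
  · exact h' ▸ le_sup_right
  · exfalso
    -- If `A/J` were perfect, `A` would lie in every derived term modulo `J`, against solvability.
    have key : ∀ k, A ≤ J ⊔ LieAlgebra.derivedSeries F L k := by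
      intro k
      induction k with
      | zero => simp [LieAlgebra.derivedSeries_def]
      | succ k ih =>
        have : ⁅A, A⁆ ≤ J ⊔ LieAlgebra.derivedSeries F L (k + 1) := by
          rw [LieAlgebra.derivedSeries_def, LieAlgebra.derivedSeriesOfIdeal_succ,
            ← LieAlgebra.derivedSeries_def]
          exact (LieSubmodule.mono_lie ih ih).trans (lie_sup_self_le _ _)
        exact h'.symm.le.trans (sup_le le_sup_left this)
    obtain ⟨k, hk⟩ := LieAlgebra.IsSolvable.solvable F L
    have := key k
    rw [hk, sup_bot_eq] at this
    exact h.1.2 this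

/-- As `A/J` is abelian and `M + A = L`, the intersection is an ideal between `J` and `A`.
Maximality of `M` is not needed, which lets this apply to other supplements of `A`. -/
theorem inf_eq_of_covBy_of_not_le [LieAlgebra.IsSolvable L] {J A : LieIdeal F L} (h : J ⋖ A)
    {M : LieSubalgebra F L} (htop : M ⊔ A.toLieSubalgebra = ⊤) (hJ : J.toLieSubalgebra ≤ M)
    (hA : ¬ A.toLieSubalgebra ≤ M) : M ⊓ A.toLieSubalgebra = J.toLieSubalgebra := by
  obtain ⟨D, hD⟩ := exists_ideal_eq_inf (N := A) htop fun a ha y hy _ =>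
    hJ (lie_self_le_of_covBy h (LieSubmodule.lie_mem_lie ha hy))
  have hD' : ∀ x, x ∈ D ↔ x ∈ M ∧ x ∈ A := fun x => mem_iff_of_toLieSubalgebra_eq_inf hD
  rcases h.eq_or_eq (c := D) (fun x hx => (hD' x).2 ⟨hJ hx, h.le hx⟩)
    (fun x hx => ((hD' x).1 hx).2) with h' | h'
  · rw [← hD, h']
  · exact absurd (fun x hx => ((hD' x).1 (h'.symm ▸ hx)).1) hA

/-- `L / I` is complemented, expressed in `L`. -/
def IsComplementedOver (I : LieIdeal F L) : Prop :=
  ∀ S : LieSubalgebra F L, I.toLieSubalgebra ≤ S →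
    ∃ T : LieSubalgebra F L, I.toLieSubalgebra ≤ T ∧ S ⊓ T ≤ I.toLieSubalgebra ∧ S ⊔ T = ⊤

/-- The intersection of the maximal subalgebras that contain the ideal `I`. -/
def frattiniOver (I : LieIdeal F L) : LieSubalgebra F L :=
  sInf {M : LieSubalgebra F L | IsCoatom M ∧ I.toLieSubalgebra ≤ M}

theorem le_frattiniOver (I : LieIdeal F L) : I.toLieSubalgebra ≤ frattiniOver I :=
  le_sInf fun _ h => h.2

theorem frattiniOver_le {I : LieIdeal F L} {M : LieSubalgebra F L} (hM : IsCoatom M)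
    (h : I.toLieSubalgebra ≤ M) : frattiniOver I ≤ M :=
  sInf_le ⟨hM, h⟩

theorem frattiniOver_mono {I J : LieIdeal F L} (h : I ≤ J) : frattiniOver I ≤ frattiniOver J :=
  le_sInf fun _ hM => frattiniOver_le hM.1 (le_trans (fun _ hx => h hx) hM.2)

theorem frattiniOver_bot : frattiniOver (⊥ : LieIdeal F L) = frattini F L := by
  unfold frattiniOver frattini
  congr 1
  ext M
  refine ⟨fun h => h.1, fun h => ⟨h, fun x hx => ?_⟩⟩
  have : x = 0 := hx
  exact this ▸ M.zero_mem

theorem isComplementedOver_top : IsComplementedOver (⊤ : LieIdeal F L) := fun S _ =>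
  ⟨⊤, le_top, fun x _ => (LieSubmodule.mem_top x : x ∈ (⊤ : LieIdeal F L)), sup_top_eq S⟩

theorem IsComplementedOver.mono {I J : LieIdeal F L} (hI : IsComplementedOver I) (h : I ≤ J) :
    IsComplementedOver J := by
  intro S hS
  obtain ⟨T, -, hST, htop⟩ := hI S (le_trans (fun _ hx => h hx) hS)
  refine ⟨T ⊔ J.toLieSubalgebra, le_sup_right, ?_, ?_⟩
  · rw [inf_comm]
    refine (inf_sup_ideal_le hS).trans (sup_le ?_ le_rfl)
    rw [inf_comm]
    exact hST.trans fun _ hx => h hx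
  · exact top_le_iff.1 (htop.symm.le.trans (sup_le_sup_left le_sup_left _))

/-- A proper complement of the Frattini subalgebra would lie in a maximal subalgebra together with
it, so the only complement is everything. -/
theorem IsComplementedOver.frattiniOver_le [FiniteDimensional F L] {I : LieIdeal F L}
    (h : IsComplementedOver I) : frattiniOver I ≤ I.toLieSubalgebra := by
  obtain ⟨T, hIT, hST, htop⟩ := h _ (le_frattiniOver I)
  rcases eq_top_or_exists_le_coatom T with rfl | ⟨M, hM, hTM⟩
  · simpa using hST
  · exact absurd (top_le_iff.1 (htop.symm.le.trans
      (sup_le (SolvLie.frattiniOver_le hM (hIT.trans hTM)) hTM))) hM.1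

/-- Complementation passes down a chief factor that is avoided by some maximal subalgebra. -/
theorem IsComplementedOver.of_covBy [LieAlgebra.IsSolvable L] {J A : LieIdeal F L}
    (hA : IsComplementedOver A) (h : J ⋖ A) {M : LieSubalgebra F L}
    (htopM : M ⊔ A.toLieSubalgebra = ⊤)
    (hJM : J.toLieSubalgebra ≤ M) (hAM : ¬ A.toLieSubalgebra ≤ M) : IsComplementedOver J := by
  intro S hJS
  have hJA : J.toLieSubalgebra ≤ A.toLieSubalgebra := fun _ hx => h.le hx
  obtain ⟨T, hAT, hST, htop⟩ := hA (S ⊔ A.toLieSubalgebra) le_sup_right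
  have hMA := inf_eq_of_covBy_of_not_le h htopM hJM hAM
  -- If `S` avoids `A/J`, the complement `T` of `S + A` already works; otherwise `T` is cut down to
  -- `M ∩ T`.
  by_cases hSA : S ⊓ A.toLieSubalgebra ≤ J.toLieSubalgebra
  · refine ⟨T, hJA.trans hAT, ?_, ?_⟩
    · exact le_trans (le_inf inf_le_left (le_trans (inf_le_inf_right T le_sup_left) hST)) hSA
    · rwa [sup_assoc, sup_eq_right.2 hAT] at htop
  · have hT : T ≤ (M ⊓ T) ⊔ A.toLieSubalgebra :=
      le_trans (le_inf (htopM ▸ le_top) le_rfl) (inf_sup_ideal_le hAT)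
    refine ⟨M ⊓ T, le_inf hJM (hJA.trans hAT), ?_, ?_⟩
    · rw [← hMA]
      refine le_inf (inf_le_right.trans inf_le_left) ?_
      exact le_trans (inf_le_inf le_sup_left inf_le_right) hST
    · set K := S ⊔ (M ⊓ T) with hK
      have hKA : K ⊔ A.toLieSubalgebra = ⊤ := by
        rw [eq_top_iff, ← htop]
        refine sup_le (sup_le_sup_right le_sup_left _) (hT.trans (sup_le_sup_right le_sup_right _))
      -- `K` supplements `A` and meets it in more than `J`, so it must contain `A`.
      have hAK : A.toLieSubalgebra ≤ K := by
        by_contra hAK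
        have := inf_eq_of_covBy_of_not_le h hKA (hJS.trans le_sup_left) hAK
        exact hSA (this ▸ inf_le_inf_right _ le_sup_left)
      rwa [sup_eq_left.2 hAK] at hKA

/-- The ideals with solvable complemented quotient are closed under intersection. -/
theorem IsComplementedOver.inf [FiniteDimensional F L] [LieAlgebra.IsSolvable L]
    {I I' : LieIdeal F L} (hI : IsComplementedOver I) (hI' : IsComplementedOver I') :
    IsComplementedOver (I ⊓ I') := by
  -- Descend from `I` to `I ∩ I'` one chief factor `A/J` at a time. By modularity `A` is not inside
  -- `J + I'`, and the quotient by `J + I'` has zero Frattini subalgebra, so some maximal subalgebra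
  -- avoids `A/J`.
  suffices H : ∀ J : LieIdeal F L, I ⊓ I' ≤ J → J ≤ I → IsComplementedOver J from
    H _ le_rfl inf_le_left
  intro J
  induction J using WellFoundedGT.induction with
  | ind J ih =>
    intro hJ hJI
    rcases hJI.eq_or_lt with rfl | hlt
    · exact hI
    have := wellFoundedLT_lieIdeal (F := F) (L := L)
    obtain ⟨A, hJA, hAI⟩ := exists_covBy_le_of_lt hlt
    have hA := ih A hJA.lt (hJ.trans hJA.le) hAI
    have hJI' := (hI'.mono (J := J ⊔ I') le_sup_right).frattiniOver_le
    have hnot : ¬ A ≤ J ⊔ I' := by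
      intro hle
      have : A ≤ J := by
        calc A ≤ (J ⊔ I') ⊓ A := le_inf hle le_rfl
          _ ≤ J ⊔ (I' ⊓ A) := sup_inf_le_assoc_of_le _ hJA.le
          _ ≤ J := sup_le le_rfl (le_trans (le_inf (inf_le_right.trans hAI) inf_le_left) hJ)
      exact hJA.lt.not_ge this
    have : ∃ M : LieSubalgebra F L, IsCoatom M ∧ (J ⊔ I').toLieSubalgebra ≤ M ∧
        ¬ A.toLieSubalgebra ≤ M := by
      by_contra! hcon
      exact hnot fun x hx => hJI' ((le_sInf fun M hM => hcon M hM.1 hM.2 :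
        A.toLieSubalgebra ≤ frattiniOver (J ⊔ I')) hx)
    obtain ⟨M, hM, hJM, hAM⟩ := this
    exact hA.of_covBy hJA (sup_ideal_eq_top hM hAM)
      (le_trans (fun x hx => (le_sup_left : J ≤ J ⊔ I') hx) hJM) hAM

end Basic

/-! ### The Frattini subalgebra is a nilpotent ideal -/

section FrattiniIdeal

variable {F L : Type*} [Field F] [LieRing L] [LieAlgebra F L]

/-- The image of `M` under `1 + ad a`, enlarged by `I`, where `a` lies in an ideal that is abelian
modulo `I`. -/
def conjSubalgebra (M : LieSubalgebra F L) {I A : LieIdeal F L} (hI : ⁅A, A⁆ ≤ I) {a : L}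
    (ha : a ∈ A) : LieSubalgebra F L where
  carrier := {z | ∃ m ∈ M, ∃ i ∈ I, m + ⁅a, m⁆ + i = z}
  add_mem' := by
    rintro _ _ ⟨m, hm, i, hi, rfl⟩ ⟨n, hn, j, hj, rfl⟩
    refine ⟨m + n, add_mem hm hn, i + j, add_mem hi hj, ?_⟩
    rw [lie_add]; abel
  zero_mem' := ⟨0, M.zero_mem, 0, I.zero_mem, by simp⟩
  smul_mem' := by
    rintro c _ ⟨m, hm, i, hi, rfl⟩
    exact ⟨c • m, M.smul_mem c hm, c • i, I.smul_mem c hi, by simp⟩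
  lie_mem' := by
    rintro _ _ ⟨m, hm, i, hi, rfl⟩ ⟨n, hn, j, hj, rfl⟩
    -- By Leibniz, `1 + ad a` fails to preserve the bracket only by `[[a,m],[a,n]]`, which lies in
    -- `[A, A] ≤ I`.
    refine ⟨⁅m, n⁆, M.lie_mem hm hn,
      ⁅⁅a, m⁆, ⁅a, n⁆⁆ + ⁅m + ⁅a, m⁆ + i, j⁆ + ⁅i, n + ⁅a, n⁆⁆, ?_, ?_⟩
    · refine add_mem (add_mem (hI (LieSubmodule.lie_mem_lie ?_ ?_))
        (lie_mem_right F L I _ _ hj)) (lie_mem_left F L I _ _ hi)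
      · exact lie_mem_left F L A _ _ ha
      · exact lie_mem_left F L A _ _ ha
    · rw [leibniz_lie a m n]
      simp only [add_lie, lie_add]
      abel

variable [FiniteDimensional F L]

/-- For `x ∈ P`, Fitting's decomposition writes `L` as the Engel subalgebra of `x` plus the image of
a power of `ad x`. That image lies in `P`, hence in every maximal subalgebra, so the Engel
subalgebra cannot be proper. -/
theorem isNilpotent_of_toLieSubalgebra_le_frattini {P : LieIdeal F L}
    (hP : P.toLieSubalgebra ≤ frattini F L) : LieRing.IsNilpotent P := by
  refine LieSubalgebra.isNilpotent_of_forall_le_engel (R := F) P.toLieSubalgebra fun x hx => ?_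
  suffices h : LieSubalgebra.engel F x = ⊤ from h ▸ le_top
  rcases eq_top_or_exists_le_coatom (LieSubalgebra.engel F x) with h | ⟨M, hM, hxM⟩
  · exact h
  exfalso
  refine hM.1 (top_le_iff.1 fun y _ => ?_)
  have hPM : P.toLieSubalgebra ≤ M := hP.trans (sInf_le hM)
  obtain ⟨n, hn⟩ := Filter.eventually_atTop.1
    (LinearMap.eventually_codisjoint_ker_pow_range_pow (LieAlgebra.ad F L x))
  have hy : y ∈ LinearMap.ker (LieAlgebra.ad F L x ^ (n + 1)) ⊔
      LinearMap.range (LieAlgebra.ad F L x ^ (n + 1)) := by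
    rw [(hn (n + 1) (Nat.le_succ n)).eq_top]
    exact Submodule.mem_top
  obtain ⟨u, hu, _, ⟨v, rfl⟩, rfl⟩ := Submodule.mem_sup.1 hy
  refine add_mem (hxM ((LieSubalgebra.mem_engel_iff F x u).2 ⟨n + 1, hu⟩)) (hPM ?_)
  -- The exponent `n + 1` guarantees an outermost bracket with `x ∈ P`.
  rw [pow_succ']
  exact lie_mem_left F L P _ _ hx

variable [LieAlgebra.IsSolvable L]

/-- The Frattini subalgebra centralises every chief factor avoided by a maximal subalgebra. -/
theorem lie_mem_of_mem_frattiniOver {I A : LieIdeal F L} (h : I ⋖ A) {M : LieSubalgebra F L}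
    (hM : IsCoatom M) (hIM : I.toLieSubalgebra ≤ M) (hAM : ¬ A.toLieSubalgebra ≤ M) {a x : L}
    (ha : a ∈ A) (hx : x ∈ frattiniOver I) : ⁅a, x⁆ ∈ I := by
  have hAA := lie_self_le_of_covBy h
  have htop := sup_ideal_eq_top hM hAM
  have hMA := inf_eq_of_covBy_of_not_le h htop hIM hAM
  -- In place of an automorphism `exp (ad a)`, the map `1 + ad a` yields a second complement of
  -- `A/I`. Since `x` and `x + [a,x]` both lie in a maximal subalgebra over it, so does `[a,x]`.
  set T := conjSubalgebra M hAA ha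
  have hIT : I.toLieSubalgebra ≤ T := fun i hi => ⟨0, M.zero_mem, i, hi, by simp⟩
  have hAT : ¬ A.toLieSubalgebra ≤ T := by
    intro hAT
    refine h.lt.not_ge fun b hb => ?_
    obtain ⟨m, hm, i, hi, rfl⟩ := hAT hb
    have hmA : m ∈ A := by
      have := sub_mem (sub_mem hb (h.le hi)) (lie_mem_left F L A a m ha)
      simpa using this
    have hmI : m ∈ I := by
      have : m ∈ M ⊓ A.toLieSubalgebra := ⟨hm, hmA⟩
      rwa [hMA] at this
    exact add_mem (add_mem hmI (lie_mem_right F L I _ _ hmI)) hi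
  have hTA : T ⊔ A.toLieSubalgebra = ⊤ := by
    rw [eq_top_iff, ← htop]
    refine sup_le (fun m hm => mem_sup_ideal.2 ⟨m + ⁅a, m⁆ + 0, ⟨m, hm, 0, I.zero_mem, rfl⟩,
      -⁅a, m⁆, neg_mem (lie_mem_left F L A _ _ ha), by abel⟩) le_sup_right
  rcases eq_top_or_exists_le_coatom T with hT | ⟨K, hK, hTK⟩
  · exact absurd (hT ▸ le_top) hAT
  have hAK : ¬ A.toLieSubalgebra ≤ K := fun hAK =>
    hK.1 (top_le_iff.1 (hTA.symm.le.trans (sup_le hTK hAK)))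
  have hKA := inf_eq_of_covBy_of_not_le h (sup_ideal_eq_top hK hAK) (hIT.trans hTK) hAK
  have hxM : x ∈ M := frattiniOver_le hM hIM hx
  have hxK : x ∈ K := frattiniOver_le hK (hIT.trans hTK) hx
  have hxK' : x + ⁅a, x⁆ + 0 ∈ K := hTK ⟨x, hxM, 0, I.zero_mem, rfl⟩
  have : ⁅a, x⁆ ∈ K ⊓ A.toLieSubalgebra :=
    ⟨by simpa using sub_mem hxK' hxK, lie_mem_left F L A _ _ ha⟩
  rwa [hKA] at this

/-- An ideal contained in a complement `M` of the chief factor `A / I` and in all maximal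
subalgebras containing `A` lies in all maximal subalgebras containing `I`. -/
theorem le_frattiniOver_of_le {I A E : LieIdeal F L} (h : I ⋖ A) {M : LieSubalgebra F L}
    (hM : IsCoatom M) (hIM : I.toLieSubalgebra ≤ M) (hAM : ¬ A.toLieSubalgebra ≤ M)
    (hEM : E.toLieSubalgebra ≤ M) (hEA : E.toLieSubalgebra ≤ frattiniOver A) :
    E.toLieSubalgebra ≤ frattiniOver I := by
  refine le_sInf ?_
  rintro K ⟨hK, hIK⟩
  by_contra hEK
  have htop := sup_ideal_eq_top hM hAM
  have hMA := inf_eq_of_covBy_of_not_le h htop hIM hAM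
  have hKE := sup_ideal_eq_top hK hEK
  have hME : M ≤ (M ⊓ K) ⊔ E.toLieSubalgebra := by
    rw [inf_comm]
    exact le_trans (le_inf (hKE ▸ le_top) le_rfl) (inf_sup_ideal_le hEM)
  -- If `(M ∩ K) + A = L`, Dedekind's law forces `M ≤ K`. Otherwise a maximal `N` above it contains
  -- `A`, hence `E`, hence `M = (M ∩ K) + E`, and so everything.
  rcases eq_top_or_exists_le_coatom ((M ⊓ K) ⊔ A.toLieSubalgebra) with hT | ⟨N, hN, hTN⟩
  · have hMK : M ≤ K := by
      refine le_trans (le_inf (hT ▸ le_top) le_rfl)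
        ((sup_ideal_inf_le (A := A) (inf_le_left : M ⊓ K ≤ M)).trans (sup_le inf_le_right ?_))
      rw [inf_comm, hMA]
      exact hIK
    exact hEK (hEM.trans hMK)
  · have hAN := le_sup_right.trans hTN
    have hEN := hEA.trans (frattiniOver_le hN hAN)
    refine hN.1 (top_le_iff.1 (htop.symm.le.trans (sup_le (hME.trans (sup_le ?_ hEN)) hAN)))
    exact le_sup_left.trans hTN

/-- The Frattini subalgebra of a solvable Lie algebra is an ideal. -/
theorem exists_ideal_eq_frattiniOver (I : LieIdeal F L) :
    ∃ P : LieIdeal F L, P.toLieSubalgebra = frattiniOver I := by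
  induction I using WellFoundedGT.induction with
  | ind I ih =>
    rcases eq_or_ne I ⊤ with rfl | hI
    · exact ⟨⊤, le_antisymm (le_frattiniOver _)
        (fun x _ => (LieSubmodule.mem_top x : x ∈ (⊤ : LieIdeal F L)))⟩
    have := wellFoundedLT_lieIdeal (F := F) (L := L)
    obtain ⟨A, hIA, -⟩ := exists_covBy_le_of_lt hI.lt_top
    obtain ⟨N, hN⟩ := ih A hIA.lt
    by_cases hA : A.toLieSubalgebra ≤ frattiniOver I
    · refine ⟨N, le_antisymm ?_ (hN ▸ frattiniOver_mono hIA.le)⟩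
      rw [hN]
      exact le_sInf fun M hM => frattiniOver_le hM.1 (hA.trans (frattiniOver_le hM.1 hM.2))
    have : ∃ M : LieSubalgebra F L, IsCoatom M ∧ I.toLieSubalgebra ≤ M ∧
        ¬ A.toLieSubalgebra ≤ M := by
      by_contra! hcon
      exact hA (le_sInf fun M hM => hcon M hM.1 hM.2)
    obtain ⟨M, hM, hIM, hAM⟩ := this
    have htop := sup_ideal_eq_top hM hAM
    -- `E` is the part of `M ∩ N` centralising `A/I`. The centralising condition makes it stable
    -- under `A` as well as under `M`, hence an ideal.
    let E : LieIdeal F L :=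
      { carrier := {x | (x ∈ M ∧ x ∈ N) ∧ ∀ a ∈ A, ⁅a, x⁆ ∈ I}
        add_mem' := fun hx hy => ⟨⟨add_mem hx.1.1 hy.1.1, add_mem hx.1.2 hy.1.2⟩,
          fun a ha => by rw [lie_add]; exact add_mem (hx.2 a ha) (hy.2 a ha)⟩
        zero_mem' := ⟨⟨M.zero_mem, N.zero_mem⟩, fun a _ => by simp⟩
        smul_mem' := fun c x hx => ⟨⟨M.smul_mem c hx.1.1, N.smul_mem c hx.1.2⟩,
          fun a ha => by rw [lie_smul]; exact I.smul_mem c (hx.2 a ha)⟩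
        lie_mem := by
          rintro y x ⟨⟨hxM, hxN⟩, hx⟩
          refine ⟨⟨?_, lie_mem_right F L N _ _ hxN⟩, fun b hb => ?_⟩
          · obtain ⟨m, hm, a, ha, rfl⟩ :=
              mem_sup_ideal.1 (htop ▸ LieSubalgebra.mem_top (R := F) y)
            rw [add_lie]
            exact add_mem (M.lie_mem hm hxM) (hIM (hx a ha))
          · rw [leibniz_lie]
            exact add_mem (hx _ (lie_mem_left F L A _ _ hb))
              (lie_mem_right F L I _ _ (hx b hb)) }
    refine ⟨E, le_antisymm ?_ ?_⟩
    · exact le_frattiniOver_of_le hIA hM hIM hAM (fun x hx => hx.1.1)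
        (fun x hx => hN ▸ hx.1.2)
    · intro x hx
      refine ⟨⟨frattiniOver_le hM hIM hx, ?_⟩,
        fun a ha => lie_mem_of_mem_frattiniOver hIA hM hIM hAM ha hx⟩
      have : x ∈ N.toLieSubalgebra := hN ▸ frattiniOver_mono hIA.le hx
      exact this

theorem exists_ideal_eq_frattini : ∃ P : LieIdeal F L, P.toLieSubalgebra = frattini F L :=
  frattiniOver_bot (F := F) (L := L) ▸ exists_ideal_eq_frattiniOver ⊥

end FrattiniIdeal

/-! ### Passage to quotients and leastness of the prefrattini residual -/

section Quotient

variable {F L L' : Type*} [Field F] [LieRing L] [LieAlgebra F L] [LieRing L'] [LieAlgebra F L']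

theorem map_sup_subalgebra (f : L →ₗ⁅F⁆ L') (S T : LieSubalgebra F L) :
    (S ⊔ T).map f = S.map f ⊔ T.map f :=
  GaloisConnection.l_sup (u := LieSubalgebra.comap f)
    fun _ _ => LieSubalgebra.map_le_iff_le_comap

theorem comap_map_eq_of_ker_le {f : L →ₗ⁅F⁆ L'} {S : LieSubalgebra F L}
    (h : f.ker.toLieSubalgebra ≤ S) : (S.map f).comap f = S := by
  refine le_antisymm (fun x hx => ?_) (fun x hx => ⟨x, hx, rfl⟩)
  obtain ⟨s, hs, hsx⟩ := hx
  have hk : x - s ∈ f.ker := by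
    rw [LieHom.mem_ker, map_sub, sub_eq_zero]
    exact hsx.symm
  simpa using add_mem (h hk) hs

theorem map_comap_eq_of_surjective {f : L →ₗ⁅F⁆ L'} (hf : Function.Surjective f)
    (S : LieSubalgebra F L') : (S.comap f).map f = S := by
  ext y
  obtain ⟨x, rfl⟩ := hf y
  constructor
  · rintro ⟨z, hz, hzx⟩
    exact hzx ▸ hz
  · exact fun h => ⟨x, h, rfl⟩

theorem isComplemented_iff_of_surjective {f : L →ₗ⁅F⁆ L'} (hf : Function.Surjective f) :
    IsComplemented F L' ↔ IsComplementedOver f.ker := by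
  constructor
  · intro h S hS
    obtain ⟨T, hST, htop⟩ := h (S.map f)
    have hT : f.ker.toLieSubalgebra ≤ T.comap f := by
      intro x hx
      have : f x = 0 := hx
      exact (this ▸ T.zero_mem : f x ∈ T)
    refine ⟨T.comap f, hT, ?_, ?_⟩
    · rintro x ⟨hxS, hxT⟩
      have : f x ∈ S.map f ⊓ T := ⟨⟨x, hxS, rfl⟩, hxT⟩
      rw [hST] at this
      exact this
    · rw [← comap_map_eq_of_ker_le (hS.trans le_sup_left : _ ≤ S ⊔ T.comap f),
        map_sup_subalgebra, map_comap_eq_of_surjective hf, htop]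
      rfl
  · intro h S
    obtain ⟨T, -, hST, htop⟩ := h (S.comap f) (by
      intro x hx
      have : f x = 0 := hx
      exact (this ▸ S.zero_mem : f x ∈ S))
    refine ⟨T.map f, ?_, ?_⟩
    · rw [eq_bot_iff]
      rintro _ ⟨hxS, ⟨t, ht, rfl⟩⟩
      exact hST ⟨hxS, ht⟩
    · rw [← map_comap_eq_of_surjective hf S, ← map_sup_subalgebra, htop, eq_top_iff]
      intro y _
      obtain ⟨x, rfl⟩ := hf y
      exact ⟨x, LieSubalgebra.mem_top x, rfl⟩

theorem comap_frattini_le {f : L →ₗ⁅F⁆ L'} (hf : Function.Surjective f) :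
    (frattini F L').comap f ≤ frattiniOver f.ker := by
  refine le_sInf ?_
  rintro M ⟨hM, hIM⟩
  have hMM := comap_map_eq_of_ker_le hIM
  have hcoatom : IsCoatom (M.map f) := by
    refine ⟨fun h => hM.1 ?_, fun K hK => ?_⟩
    · rw [← hMM, h]; rfl
    · have hlt : M < K.comap f := by
        refine lt_of_le_of_ne (fun x hx => hK.le ⟨x, hx, rfl⟩) fun h => hK.ne ?_
        rw [h, map_comap_eq_of_surjective hf]
      rw [← map_comap_eq_of_surjective hf K, hM.2 _ hlt, eq_top_iff]
      intro y _
      obtain ⟨x, rfl⟩ := hf y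
      exact ⟨x, LieSubalgebra.mem_top x, rfl⟩
  intro x hx
  rw [← hMM]
  exact (sInf_le hcoatom : frattini F L' ≤ _) hx

/-- The quotient map as a morphism of Lie algebras. -/
def quotientHom (I : LieIdeal F L) : L →ₗ⁅F⁆ L ⧸ I where
  toLinearMap := (LieSubmodule.Quotient.mk' I : L →ₗ[F] L ⧸ I)
  map_lie' := rfl

theorem quotientHom_surjective (I : LieIdeal F L) : Function.Surjective (quotientHom I) :=
  LieSubmodule.Quotient.surjective_mk' I

theorem ker_quotientHom (I : LieIdeal F L) : (quotientHom I).ker = I := by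
  ext x
  exact LieSubmodule.Quotient.mk_eq_zero' (N := I)

theorem isComplemented_quotient_iff (I : LieIdeal F L) :
    IsComplemented F (L ⧸ I) ↔ IsComplementedOver I := by
  rw [isComplemented_iff_of_surjective (quotientHom_surjective I), ker_quotientHom]

theorem isComplemented_quotient_quotient_iff {A : LieIdeal F L} (I : LieIdeal F (L ⧸ A)) :
    IsComplemented F ((L ⧸ A) ⧸ I) ↔ IsComplementedOver (I.comap (quotientHom A)) := by
  have hs : Function.Surjective ((quotientHom I).comp (quotientHom A)) :=
    (quotientHom_surjective I).comp (quotientHom_surjective A)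
  rw [isComplemented_iff_of_surjective hs]
  have : ((quotientHom I).comp (quotientHom A)).ker = I.comap (quotientHom A) := by
    ext x
    exact LieSubmodule.Quotient.mk_eq_zero' (N := I)
  rw [this]

theorem isSolvable_subalgebra [LieAlgebra.IsSolvable L] (M : LieSubalgebra F L) :
    LieAlgebra.IsSolvable M :=
  Function.Injective.lieAlgebra_isSolvable (f := M.incl) Subtype.val_injective

theorem isSolvable_quotient [LieAlgebra.IsSolvable L] (I : LieIdeal F L) :
    LieAlgebra.IsSolvable (L ⧸ I) :=
  (quotientHom_surjective I).lieAlgebra_isSolvable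

theorem mem_sInf_ideal {s : Set (LieIdeal F L)} {x : L} : x ∈ sInf s ↔ ∀ I ∈ s, x ∈ I := by
  rw [← SetLike.mem_coe, LieSubmodule.coe_sInf]
  simp

theorem mem_prefrattiniResidual_iff [LieAlgebra.IsSolvable L] {x : L} :
    x ∈ prefrattiniResidual F L ↔ ∀ I : LieIdeal F L, IsComplementedOver I → x ∈ I := by
  simp only [prefrattiniResidual, mem_sInf_ideal, Set.mem_ofPred_eq,
    isComplemented_quotient_iff, isSolvable_quotient, true_and]

theorem prefrattiniResidual_le [LieAlgebra.IsSolvable L] {I : LieIdeal F L}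
    (h : IsComplementedOver I) : prefrattiniResidual F L ≤ I :=
  fun _ hx => mem_prefrattiniResidual_iff.1 hx I h

variable [FiniteDimensional F L] [LieAlgebra.IsSolvable L]

/-- A minimal ideal with complemented quotient exists by finite dimension, and closure under
intersection makes it least. -/
theorem isComplementedOver_prefrattiniResidual :
    IsComplementedOver (prefrattiniResidual F L) := by
  have hwf := wellFoundedLT_lieIdeal (F := F) (L := L)
  obtain ⟨I, hI, hmin⟩ := hwf.wf.has_min {I : LieIdeal F L | IsComplementedOver I}
    ⟨⊤, isComplementedOver_top⟩
  have hle : I ≤ prefrattiniResidual F L := by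
    intro x hx
    refine mem_prefrattiniResidual_iff.2 fun J hJ => ?_
    by_contra hxJ
    exact hmin _ (hI.inf hJ) (inf_lt_left.2 fun h => hxJ (h hx))
  exact hI.mono hle

theorem prefrattiniResidual_quotient (A : LieIdeal F L) :
    (prefrattiniResidual F (L ⧸ A)).toSubmodule =
      (prefrattiniResidual F L ⊔ A).toSubmodule.map
        (LieSubmodule.Quotient.mk' A : L →ₗ[F] L ⧸ A) := by
  have := isSolvable_quotient A
  have hs := quotientHom_surjective A
  set N := prefrattiniResidual F L ⊔ A
  have hmap := LieIdeal.coe_map_of_surjective (I := N) hs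
  refine le_antisymm ?_ ?_
  · have : prefrattiniResidual F (L ⧸ A) ≤ N.map (quotientHom A) := by
      refine sInf_le ⟨isSolvable_quotient _, ?_⟩
      rw [isComplemented_quotient_quotient_iff]
      exact isComplementedOver_prefrattiniResidual.mono (le_sup_left.trans LieIdeal.comap_map_le)
    intro y hy
    have hy' : y ∈ (N.map (quotientHom A)).toSubmodule := this hy
    rw [hmap] at hy'
    exact hy'
  · rintro _ ⟨x, hx, rfl⟩
    refine mem_sInf_ideal.2 ?_
    rintro I ⟨-, hI⟩
    rw [isComplemented_quotient_quotient_iff] at hI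
    have hA : A ≤ I.comap (quotientHom A) := by
      conv_lhs => rw [← ker_quotientHom A]
      exact LieHom.ker_le_comap _ _
    exact (sup_le (prefrattiniResidual_le hI) hA : N ≤ _) hx

theorem frattini_le_prefrattiniResidual :
    frattini F L ≤ (prefrattiniResidual F L).toLieSubalgebra := by
  rw [← frattiniOver_bot]
  exact (frattiniOver_mono bot_le).trans isComplementedOver_prefrattiniResidual.frattiniOver_le

end Quotient

/-! ### Lower central terms of the residual and maximal subalgebras -/

section Nilpotent

variable {F L : Type*} [Field F] [LieRing L] [LieAlgebra F L]

/-- The terms of the lower central series of an ideal, as ideals of the whole algebra. -/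
def lowerCentral (N : LieIdeal F L) (k : ℕ) : LieIdeal F L :=
  (N.lcs N k).map (LieSubmodule.incl N)

theorem lowerCentral_zero (N : LieIdeal F L) : lowerCentral N 0 = N := by
  ext x
  simp [lowerCentral]

theorem lowerCentral_succ (N : LieIdeal F L) (k : ℕ) :
    lowerCentral N (k + 1) = ⁅N, lowerCentral N k⁆ := by
  rw [lowerCentral, LieIdeal.lcs_succ, LieSubmodule.map_bracket_eq, lowerCentral]

theorem lowerCentral_le (N : LieIdeal F L) (k : ℕ) : lowerCentral N k ≤ N := by
  intro x hx
  obtain ⟨y, -, rfl⟩ := (LieSubmodule.mem_map _).1 hx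
  exact y.2

theorem mem_lowerCentral_iff {N : LieIdeal F L} {k : ℕ} {x : L} :
    x ∈ lowerCentral N k ↔ ∃ y ∈ LieModule.lowerCentralSeries F N N k, (y : L) = x := by
  have h := N.coe_lcs_eq (M := N) k
  rw [lowerCentral, LieSubmodule.mem_map]
  refine exists_congr fun y => and_congr_left fun _ => ?_
  rw [← LieSubmodule.mem_toSubmodule, h]
  rfl

theorem exists_lowerCentral_eq_bot {N : LieIdeal F L} (h : LieRing.IsNilpotent N) :
    ∃ k, lowerCentral N k = ⊥ := by
  obtain ⟨k, hk⟩ := LieModule.IsNilpotent.nilpotent F N N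
  refine ⟨k, eq_bot_iff.2 fun x hx => ?_⟩
  obtain ⟨y, hy, rfl⟩ := mem_lowerCentral_iff.1 hx
  rw [hk] at hy
  have : y = 0 := hy
  simp [this]

/-- The lower central series stabilises, and its stable term dies in every nilpotent quotient. Only
this inclusion is needed for (iv). -/
theorem exists_lowerCentral_le_nilpotentResidual [FiniteDimensional F L] (N : LieIdeal F L) :
    ∃ k, ∀ x ∈ lowerCentral N k, ∃ y ∈ nilpotentResidual F N, (y : L) = x := by
  obtain ⟨k, hk⟩ := Filter.eventually_atTop.1
    (LieModule.eventually_iInf_lowerCentralSeries_eq F N N)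
  refine ⟨k, fun x hx => ?_⟩
  obtain ⟨y, hy, rfl⟩ := mem_lowerCentral_iff.1 hx
  rw [← hk k le_rfl] at hy
  refine ⟨y, mem_sInf_ideal.2 fun I hI => ?_, rfl⟩
  have hI' : LieRing.IsNilpotent (N ⧸ I) := hI
  have : LieModule.IsNilpotent N (N ⧸ I) := by
    obtain ⟨j, hj⟩ := LieModule.IsNilpotent.nilpotent F (N ⧸ I) (N ⧸ I)
    refine (LieModule.isNilpotent_iff F N (N ⧸ I)).2 ⟨j, ?_⟩
    rw [← LieSubmodule.toSubmodule_inj, coe_lowerCentralSeries_ideal_quot_eq, hj]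
    rfl
  exact LieModule.iInf_lcs_le_of_isNilpotent_quot F N N I this hy

/-- The last lower central term not inside `M` supplements `M`, and its bracket with `N` is the next
term, which is inside `M`. -/
theorem exists_ideal_eq_inf_covBy_of_lowerCentral_le {M : LieSubalgebra F L} (hM : IsCoatom M)
    {N : LieIdeal F L} {k : ℕ} (hk : (lowerCentral N k).toLieSubalgebra ≤ M)
    (hN : ¬ N.toLieSubalgebra ≤ M) :
    ∃ D : LieIdeal F L, D.toLieSubalgebra = M ⊓ N.toLieSubalgebra ∧ D ⋖ N := by
  induction k with
  | zero => exact absurd (lowerCentral_zero N ▸ hk) hN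
  | succ k ih =>
    by_cases h : (lowerCentral N k).toLieSubalgebra ≤ M
    · exact ih h
    · refine exists_ideal_eq_inf_covBy hM h (lowerCentral_le N k) fun a ha y hy _ => hk ?_
      rw [LieIdeal.mem_toLieSubalgebra, lowerCentral_succ, LieSubmodule.lie_comm]
      exact LieSubmodule.lie_mem_lie ha hy

/-- The derived algebra of a nilpotent ideal lies in every maximal subalgebra. -/
theorem lie_self_le_frattini [LieAlgebra.IsSolvable L] {N : LieIdeal F L}
    (h : LieRing.IsNilpotent N) : (⁅N, N⁆ : LieIdeal F L).toLieSubalgebra ≤ frattini F L := by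
  refine le_sInf fun M hM => ?_
  obtain ⟨k, hk⟩ := exists_lowerCentral_eq_bot h
  by_cases hN : N.toLieSubalgebra ≤ M
  · exact le_trans (fun x hx => LieSubmodule.lie_le_right N N hx) hN
  · obtain ⟨D, hD, hDN⟩ := exists_ideal_eq_inf_covBy_of_lowerCentral_le hM (k := k) (N := N) (by
      intro x hx
      rw [LieIdeal.mem_toLieSubalgebra, hk, LieSubmodule.mem_bot] at hx
      exact hx ▸ M.zero_mem) hN
    refine le_trans (b := D.toLieSubalgebra) (fun x hx => lie_self_le_of_covBy hDN hx) ?_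
    exact hD ▸ inf_le_left

/-- If `N` does not centralise the chief factor, then `[N, A] + J = A`, and this identity can be
iterated. -/
theorem lie_le_or_le_lowerCentral_sup {J A : LieIdeal F L} (h : J ⋖ A) (N : LieIdeal F L) :
    ⁅N, A⁆ ≤ J ∨ ∀ k, A ≤ lowerCentral N k ⊔ J := by
  rcases h.eq_or_eq (c := ⁅N, A⁆ ⊔ J) le_sup_right
    (sup_le (LieSubmodule.lie_le_right A N) h.le) with h' | h'
  · exact Or.inl (h' ▸ le_sup_left)
  · right
    intro k
    induction k with
    | zero =>
      rw [lowerCentral_zero]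
      exact h'.symm.le.trans (sup_le_sup_right (LieSubmodule.lie_le_left N A) J)
    | succ k ih =>
      refine h'.symm.le.trans (sup_le ?_ le_sup_right)
      refine (LieSubmodule.mono_lie_right N ih).trans ?_
      rw [LieSubmodule.lie_sup, ← lowerCentral_succ]
      exact sup_le_sup_left (LieSubmodule.lie_le_right J N) _

variable [FiniteDimensional F L] [LieAlgebra.IsSolvable L]

/-- Otherwise `M` would complement a chief factor `π(L)/D`, and the descent would make `L/D`
complemented, against leastness of `π(L)`. -/
theorem prefrattiniResidual_le_of_lowerCentral_le {M : LieSubalgebra F L} (hM : IsCoatom M)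
    {k : ℕ} (hk : (lowerCentral (prefrattiniResidual F L) k).toLieSubalgebra ≤ M) :
    (prefrattiniResidual F L).toLieSubalgebra ≤ M := by
  by_contra hN
  obtain ⟨D, hD, hDN⟩ := exists_ideal_eq_inf_covBy_of_lowerCentral_le hM hk hN
  have := isComplementedOver_prefrattiniResidual.of_covBy hDN (sup_ideal_eq_top hM hN)
    (hD ▸ inf_le_left) hN
  exact hDN.lt.not_ge (prefrattiniResidual_le this)

theorem isNilpotent_prefrattiniResidual_iff :
    LieRing.IsNilpotent (prefrattiniResidual F L) ↔
      (prefrattiniResidual F L).toLieSubalgebra = frattini F L := by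
  refine ⟨fun h => le_antisymm (le_sInf fun M hM => ?_) frattini_le_prefrattiniResidual,
    fun h => isNilpotent_of_toLieSubalgebra_le_frattini h.le⟩
  obtain ⟨k, hk⟩ := exists_lowerCentral_eq_bot h
  refine prefrattiniResidual_le_of_lowerCentral_le hM (k := k) fun x hx => ?_
  rw [LieIdeal.mem_toLieSubalgebra, hk, LieSubmodule.mem_bot] at hx
  exact hx ▸ M.zero_mem

/-- A maximal subalgebra avoiding a chief factor centralised by the prefrattini residual contains
the prefrattini residual. -/
theorem prefrattiniResidual_le_of_lie_le {J A : LieIdeal F L} (h : J ⋖ A) {M : LieSubalgebra F L}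
    (hM : IsCoatom M) (hJM : J.toLieSubalgebra ≤ M) (hAM : ¬ A.toLieSubalgebra ≤ M)
    (hlie : ⁅prefrattiniResidual F L, A⁆ ≤ J) :
    (prefrattiniResidual F L).toLieSubalgebra ≤ M := by
  -- `A` centralises `N` modulo `J`, so `M ∩ N` is an ideal covered by `N` and the descent applies
  -- to it.
  set N := prefrattiniResidual F L ⊔ A
  have hAN : A ≤ N := le_sup_right
  have hAN' : ⁅A, N⁆ ≤ J := by
    rw [LieSubmodule.lie_sup, LieSubmodule.lie_comm]
    exact sup_le hlie (lie_self_le_of_covBy h)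
  obtain ⟨D, hD, hDN⟩ := exists_ideal_eq_inf_covBy hM hAM hAN
    fun a ha y hy _ => hJM (hAN' (LieSubmodule.lie_mem_lie ha hy))
  have hNM : ¬ N.toLieSubalgebra ≤ M := fun hNM => hAM (le_trans (fun x hx => hAN hx) hNM)
  have := (isComplementedOver_prefrattiniResidual.mono (J := N) le_sup_left).of_covBy hDN
    (sup_ideal_eq_top hM hNM) (hD ▸ inf_le_left) hNM
  have hDM : D.toLieSubalgebra ≤ M := hD ▸ inf_le_left
  exact fun x hx => hDM (prefrattiniResidual_le this hx)

theorem prefrattiniResidual_le_of_not_le {J A : LieIdeal F L} (h : J ⋖ A) {M : LieSubalgebra F L}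
    (hM : IsCoatom M) (hJM : J.toLieSubalgebra ≤ M) (hAM : ¬ A.toLieSubalgebra ≤ M) {k : ℕ}
    (hk : ¬ A ≤ lowerCentral (prefrattiniResidual F L) k ⊔ J) :
    (prefrattiniResidual F L).toLieSubalgebra ≤ M :=
  prefrattiniResidual_le_of_lie_le h hM hJM hAM
    ((lie_le_or_le_lowerCentral_sup h _).resolve_right fun h' => hk (h' k))

end Nilpotent

/-! ### Prefrattini subalgebras: downward induction along a chief series -/

section Prefrattini

variable {F L : Type*} [Field F] [LieRing L] [LieAlgebra F L]

/-- The intersection of the chosen maximal subalgebras with index at least `k`. -/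
def ChiefSeries.partialInf (s : ChiefSeries F L) (M : Fin s.n → LieSubalgebra F L)
    (k : Fin (s.n + 1)) : LieSubalgebra F L :=
  ⨅ (i : Fin s.n) (_ : ¬ s.IsFrattini i ∧ k ≤ i.castSucc), M i

/-- The condition on a choice of maximal subalgebras avoiding the non-Frattini chief factors. -/
def ChiefSeries.IsAvoiding (s : ChiefSeries F L) (M : Fin s.n → LieSubalgebra F L) : Prop :=
  ∀ i, ¬ s.IsFrattini i →
    IsCoatom (M i) ∧ (s.A i.castSucc).toLieSubalgebra ≤ M i ∧
      ¬ (s.A i.succ).toLieSubalgebra ≤ M i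

variable {s : ChiefSeries F L} {M : Fin s.n → LieSubalgebra F L}

theorem ChiefSeries.partialInf_le {k : Fin (s.n + 1)} {i : Fin s.n} (hi : ¬ s.IsFrattini i)
    (hk : k ≤ i.castSucc) : s.partialInf M k ≤ M i :=
  iInf₂_le i ⟨hi, hk⟩

theorem ChiefSeries.partialInf_castSucc_le_succ (i : Fin s.n) :
    s.partialInf M i.castSucc ≤ s.partialInf M i.succ :=
  le_iInf₂ fun _ hj => s.partialInf_le hj.1 (i.castSucc_lt_succ.le.trans hj.2)

theorem ChiefSeries.partialInf_succ_inf_le (i : Fin s.n) :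
    s.partialInf M i.succ ⊓ M i ≤ s.partialInf M i.castSucc := by
  refine le_iInf₂ fun j hj => ?_
  rcases eq_or_ne j i with rfl | hne
  · exact inf_le_right
  · refine inf_le_left.trans (s.partialInf_le hj.1 ?_)
    have h1 : i ≤ j := hj.2
    exact Fin.succ_le_castSucc_iff.2 (lt_of_le_of_ne h1 hne.symm)

theorem ChiefSeries.partialInf_succ_le_of_isFrattini {i : Fin s.n} (hi : s.IsFrattini i) :
    s.partialInf M i.succ ≤ s.partialInf M i.castSucc := by
  refine le_iInf₂ fun j hj => s.partialInf_le hj.1 ?_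
  have h1 : i ≤ j := hj.2
  exact Fin.succ_le_castSucc_iff.2 (lt_of_le_of_ne h1 fun h => hj.1 (h ▸ hi))

theorem ChiefSeries.le_partialInf (hM : s.IsAvoiding M) (k : Fin (s.n + 1)) :
    (s.A k).toLieSubalgebra ≤ s.partialInf M k := by
  have hmono : Monotone s.A := Fin.monotone_iff_le_succ.2 fun i => (s.step i).le
  exact le_iInf₂ fun i hi => le_trans (fun x hx => hmono hi.2 hx) (hM i hi.1).2.1

variable [FiniteDimensional F L] [LieAlgebra.IsSolvable L]

/-- The quotient by `π(L) + A i` is complemented, so it has zero Frattini subalgebra. -/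
theorem ChiefSeries.le_of_isFrattini {i : Fin s.n} (hi : s.IsFrattini i) :
    s.A i.succ ≤ prefrattiniResidual F L ⊔ s.A i.castSucc := by
  have h1 := comap_frattini_le (quotientHom_surjective (s.A i.castSucc))
  rw [ker_quotientHom] at h1
  have h2 : IsComplementedOver (prefrattiniResidual F L ⊔ s.A i.castSucc) :=
    isComplementedOver_prefrattiniResidual.mono le_sup_left
  exact fun x hx => h2.frattiniOver_le (frattiniOver_mono le_sup_right
    (h1 (hi (Submodule.mem_map_of_mem hx))))

theorem ChiefSeries.partialInf_le_prefrattiniResidual (hM : s.IsAvoiding M) (k : Fin (s.n + 1)) :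
    s.partialInf M k ≤ (prefrattiniResidual F L ⊔ s.A k).toLieSubalgebra := by
  induction k using Fin.reverseInduction with
  | last =>
    rw [s.top, sup_top_eq]
    exact fun x _ => (LieSubmodule.mem_top x : x ∈ (⊤ : LieIdeal F L))
  | cast i ih =>
    have hle := (s.partialInf_castSucc_le_succ i).trans ih
    by_cases hA : s.A i.succ ≤ prefrattiniResidual F L ⊔ s.A i.castSucc
    · exact hle.trans fun x hx => (sup_le le_sup_left hA :
        prefrattiniResidual F L ⊔ s.A i.succ ≤ _) hx
    · have hi : ¬ s.IsFrattini i := fun hi => hA (s.le_of_isFrattini hi)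
      obtain ⟨hMi, hJM, hAM⟩ := hM i hi
      -- The zeroth lower central term is `π(L)` itself. Once `M i` contains `π(L)`, Dedekind's law
      -- with `M i ∩ A (i+1) = A i` gives the step.
      have hπ := prefrattiniResidual_le_of_not_le (s.step i) hMi hJM hAM (k := 0)
        (by rwa [lowerCentral_zero])
      have hinf := inf_eq_of_covBy_of_not_le (s.step i) (sup_ideal_eq_top hMi hAM) hJM hAM
      rw [toLieSubalgebra_sup] at hle ⊢
      refine (le_inf hle (s.partialInf_le hi le_rfl)).trans ((sup_ideal_inf_le hπ).trans ?_)
      rw [inf_comm, hinf]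

theorem ChiefSeries.prefrattiniResidual_le_partialInf (hM : s.IsAvoiding M) (K : ℕ)
    (k : Fin (s.n + 1)) : (prefrattiniResidual F L).toLieSubalgebra ≤
      s.partialInf M k ⊔ (lowerCentral (prefrattiniResidual F L) K).toLieSubalgebra := by
  set R := lowerCentral (prefrattiniResidual F L) K with hR
  induction k using Fin.reverseInduction with
  | last =>
    have : s.partialInf M (Fin.last s.n) = ⊤ :=
      iInf₂_eq_top.2 fun i hi => absurd (Fin.last_le_iff.1 hi.2) (Fin.castSucc_lt_last i).ne
    rw [this, top_sup_eq]
    exact le_top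
  | cast i ih =>
    by_cases hi : s.IsFrattini i
    · exact ih.trans (sup_le_sup_right (s.partialInf_succ_le_of_isFrattini hi) _)
    obtain ⟨hMi, hJM, hAM⟩ := hM i hi
    -- If `R` covers the chief factor, what is lost by intersecting with `M i` is recovered from
    -- `R`; if not, `M i` contains `π(L)` and nothing is lost.
    by_cases hA : s.A i.succ ≤ R ⊔ s.A i.castSucc
    · have hA' : (s.A i.succ).toLieSubalgebra ≤
          s.partialInf M i.castSucc ⊔ R.toLieSubalgebra := by
        have h1 : (s.A i.succ).toLieSubalgebra ≤ (R ⊔ s.A i.castSucc).toLieSubalgebra :=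
          fun x hx => hA hx
        rw [toLieSubalgebra_sup] at h1
        exact h1.trans (sup_le le_sup_right ((s.le_partialInf hM _).trans le_sup_left))
      have h2 : s.partialInf M i.succ ≤
          (M i ⊓ s.partialInf M i.succ) ⊔ (s.A i.succ).toLieSubalgebra :=
        le_trans (le_inf (sup_ideal_eq_top hMi hAM ▸ le_top) le_rfl)
          (inf_sup_ideal_le (s.le_partialInf hM _))
      refine ih.trans (sup_le (h2.trans (sup_le ?_ hA')) le_sup_right)
      rw [inf_comm]
      exact (s.partialInf_succ_inf_le i).trans le_sup_left
    · have hπ := prefrattiniResidual_le_of_not_le (s.step i) hMi hJM hAM hA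
      have hRM : R.toLieSubalgebra ≤ M i := le_trans (fun x hx => lowerCentral_le _ _ hx) hπ
      exact (le_inf ih hπ).trans ((inf_sup_ideal_le hRM).trans
        (sup_le_sup_right (s.partialInf_succ_inf_le i) _))

theorem IsPrefrattini.prefrattiniResidual_eq {B : LieSubalgebra F L} (hB : IsPrefrattini B) :
    (prefrattiniResidual F L).toSubmodule =
      B.toSubmodule ⊔ (nilpotentResidual F (prefrattiniResidual F L)).toSubmodule.map
        (prefrattiniResidual F L).toSubmodule.subtype := by
  obtain ⟨s, M, hM, rfl⟩ := hB
  have hB : (⨅ (i : Fin s.n) (_ : ¬ s.IsFrattini i), M i) = s.partialInf M 0 := by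
    simp [ChiefSeries.partialInf]
  rw [hB]
  refine le_antisymm ?_ (sup_le ?_ ?_)
  · obtain ⟨K, hK⟩ := exists_lowerCentral_le_nilpotentResidual (prefrattiniResidual F L)
    intro x hx
    obtain ⟨b, hb, r, hr, rfl⟩ :=
      mem_sup_ideal.1 (s.prefrattiniResidual_le_partialInf hM K 0 hx)
    obtain ⟨y, hy, rfl⟩ := hK r hr
    exact Submodule.add_mem_sup hb ⟨y, hy, rfl⟩
  · have := s.partialInf_le_prefrattiniResidual hM 0
    rw [s.bot, sup_bot_eq] at this
    exact this
  · rintro _ ⟨y, -, rfl⟩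
    exact y.2

end Prefrattini

/-! ### Elementary algebras are complemented -/

section Elementary

variable {F L L' : Type*} [Field F] [LieRing L] [LieAlgebra F L] [LieRing L'] [LieAlgebra F L']

theorem frattini_eq_bot_of_equiv (e : L ≃ₗ⁅F⁆ L') (h : frattini F L = ⊥) : frattini F L' = ⊥ := by
  have hker : (e : L →ₗ⁅F⁆ L').ker = ⊥ := LieHom.ker_eq_bot _ |>.2 e.injective
  have hle := comap_frattini_le (f := (e : L →ₗ⁅F⁆ L')) e.surjective
  rw [hker, frattiniOver_bot, h] at hle
  rw [eq_bot_iff]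
  intro y hy
  obtain ⟨x, rfl⟩ := e.surjective y
  have hx : x = 0 := hle hy
  rw [hx, map_zero]
  exact LieSubalgebra.zero_mem _

theorem IsElementary.frattini_eq_bot (h : IsElementary F L) : frattini F L = ⊥ :=
  frattini_eq_bot_of_equiv LieSubalgebra.topEquiv (h ⊤)

theorem IsElementary.subalgebra (h : IsElementary F L) (M : LieSubalgebra F L) :
    IsElementary F M := by
  intro S
  have hinj : Function.Injective (M.incl.comp S.incl) :=
    Subtype.val_injective.comp Subtype.val_injective
  exact frattini_eq_bot_of_equiv (LieEquiv.ofInjective _ hinj).symm (h _)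

/-- `L/A` is a quotient of `M`, so a complement in `M` of `S ∩ M`, enlarged by `A`, serves for `S`.
-/
theorem isComplementedOver_of_isComplemented_subalgebra {M : LieSubalgebra F L} {A : LieIdeal F L}
    (htop : M ⊔ A.toLieSubalgebra = ⊤) (h : IsComplemented F M) : IsComplementedOver A := by
  intro S hAS
  obtain ⟨T, hST, hTtop⟩ := h (S.comap M.incl)
  refine ⟨T.map M.incl ⊔ A.toLieSubalgebra, le_sup_right, ?_, ?_⟩
  · rw [inf_comm]
    refine (inf_sup_ideal_le hAS).trans (sup_le ?_ le_rfl)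
    rintro _ ⟨⟨t, ht, rfl⟩, htS⟩
    have : t ∈ S.comap M.incl ⊓ T := ⟨htS, ht⟩
    rw [hST] at this
    have h0 : t = 0 := this
    rw [h0]
    exact A.zero_mem
  · rw [eq_top_iff, ← htop]
    refine sup_le ?_ (le_sup_right.trans le_sup_right)
    have h1 : M ≤ (S.comap M.incl ⊔ T).map M.incl := by
      rw [hTtop]
      exact fun m hm => ⟨⟨m, hm⟩, LieSubalgebra.mem_top _, rfl⟩
    rw [map_sup_subalgebra] at h1
    refine h1.trans (sup_le_sup ?_ le_sup_left)
    rintro _ ⟨s, hs, rfl⟩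
    exact hs

theorem IsComplementedOver.isComplemented (h : IsComplementedOver (⊥ : LieIdeal F L)) :
    IsComplemented F L := by
  intro S
  obtain ⟨T, -, hST, htop⟩ := h S fun x hx => by
    have : x = 0 := hx
    exact this ▸ S.zero_mem
  exact ⟨T, eq_bot_iff.2 fun x hx => hST hx, htop⟩

end Elementary

universe u v

/-- Solvable elementary Lie algebras are complemented. -/
theorem IsElementary.isComplemented {F : Type u} {L : Type v} [Field F] [LieRing L]
    [LieAlgebra F L] [FiniteDimensional F L] [LieAlgebra.IsSolvable L] (h : IsElementary F L) :
    IsComplemented F L := by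
  induction hn : Module.finrank F L using Nat.strong_induction_on generalizing L with
  | _ n ih =>
    refine IsComplementedOver.isComplemented ?_
    -- A maximal `M` avoids a minimal ideal `A` because the Frattini subalgebra is zero. By
    -- induction `M` is complemented, hence so is `L/A`, and the descent removes `A`.
    rcases eq_bot_or_exists_atom_le (⊤ : LieIdeal F L) with htop | ⟨A, hA, -⟩
    · exact htop ▸ isComplementedOver_top
    have hA' := bot_covBy_iff.2 hA
    have : ∃ M : LieSubalgebra F L, IsCoatom M ∧ ¬ A.toLieSubalgebra ≤ M := by
      by_contra! hcon
      have hle : A.toLieSubalgebra ≤ frattini F L := le_sInf hcon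
      rw [h.frattini_eq_bot] at hle
      exact hA.1 (eq_bot_iff.2 fun x hx => hle hx)
    obtain ⟨M, hM, hAM⟩ := this
    have htop := sup_ideal_eq_top hM hAM
    have hMlt : Module.finrank F M < n := by
      rw [← hn]
      refine Submodule.finrank_lt (s := M.toSubmodule) fun hMtop => hM.1 ?_
      exact LieSubalgebra.toSubmodule_injective hMtop
    have := isSolvable_subalgebra M
    have hMc : IsComplemented F M := ih _ hMlt (h.subalgebra M) rfl
    exact (isComplementedOver_of_isComplemented_subalgebra htop hMc).of_covBy hA' htop
      (fun x hx => by
        have : x = 0 := hx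
        exact this ▸ M.zero_mem) hAM

theorem prefrattiniResidual_le_elementaryCommutator {F L : Type*} [Field F] [LieRing L]
    [LieAlgebra F L] [FiniteDimensional F L] :
    prefrattiniResidual F L ≤ elementaryCommutator F L := by
  refine sInf_le_sInf ?_
  rintro I ⟨hs, he⟩
  exact ⟨hs, he.isComplemented⟩

/-! ### Restricting semisimple modules with commuting operators -/

section Semisimple

variable {F L V : Type*} [Field F] [LieRing L] [AddCommGroup V] [Module F V] [LieRingModule L V]

theorem isAtom_or_eq_bot_map {W : LieSubmodule F L V} (hW : IsAtom W) (f : V →ₗ⁅F,L⁆ V) :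
    IsAtom (W.map f) ∨ W.map f = ⊥ := by
  rw [or_iff_not_imp_right]
  refine fun hne => ⟨hne, fun X hX => ?_⟩
  rcases hW.le_iff.1 (inf_le_left : W ⊓ X.comap f ≤ W) with h | h
  · rw [eq_bot_iff]
    intro y hy
    obtain ⟨w, hw, rfl⟩ := (LieSubmodule.mem_map _).1 (hX.le hy)
    have : w ∈ W ⊓ X.comap f := ⟨hw, hy⟩
    rw [h, LieSubmodule.mem_bot] at this
    rw [this, map_zero]
    exact LieSubmodule.zero_mem _
  · refine absurd ?_ hX.not_ge
    exact LieSubmodule.map_le_iff_le_comap.2 (inf_eq_left.1 h)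

variable [LieAlgebra F L] [LieModule F L V]

/-- The restriction of a semisimple module to a subalgebra is semisimple, if the operators by which
the Lie algebra acts commute. -/
theorem complementedLattice_restrict [FiniteDimensional F V]
    [ComplementedLattice (LieSubmodule F L V)]
    (hcomm : ∀ (x y : L) (v : V), ⁅x, ⁅y, v⁆⁆ = ⁅y, ⁅x, v⁆⁆) (S : LieSubalgebra F L) :
    ComplementedLattice (LieSubmodule F S V) := by
  -- Commutation makes each operator of `L` an `S`-endomorphism, so the `S`-socle is `L`-stable. An
  -- `L`-complement of it contains no simple `S`-submodule and vanishes.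
  let soc : LieSubmodule F S V := sSup {W | IsAtom W}
  let act : L → (V →ₗ⁅F,S⁆ V) := fun x =>
    { LieModule.toEnd F L V x with map_lie' := fun {s v} => hcomm x s v }
  have hact : ∀ x, soc.map (act x) ≤ soc := by
    intro x
    rw [LieSubmodule.map_le_iff_le_comap]
    refine sSup_le fun W hW => ?_
    rw [← LieSubmodule.map_le_iff_le_comap]
    rcases isAtom_or_eq_bot_map hW (act x) with h | h
    · exact le_sSup h
    · exact h ▸ bot_le
  let N : LieSubmodule F L V :=
    { soc.toSubmodule with
      lie_mem := fun {x v} hv => hact x (LieSubmodule.mem_map_of_mem (f := act x) hv) }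
  obtain ⟨X, hX⟩ := exists_isCompl N
  let X' : LieSubmodule F S V :=
    { X.toSubmodule with lie_mem := fun {s v} hv => X.lie_mem (x := (s : L)) hv }
  have hX' : X' = ⊥ := by
    rcases eq_bot_or_exists_atom_le X' with h | ⟨W, hW, hWX⟩
    · exact h
    · refine absurd (eq_bot_iff.2 fun w hw => ?_) hW.1
      have h1 : w ∈ N := (le_sSup hW : W ≤ soc) hw
      have h2 : w ∈ N ⊓ X := ⟨h1, hWX hw⟩
      rw [hX.inf_eq_bot] at h2
      exact h2
  have hsoc : soc = ⊤ := by
    rw [eq_top_iff]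
    intro v _
    have hv : v ∈ N ⊔ X := hX.sup_eq_top ▸ LieSubmodule.mem_top v
    obtain ⟨a, ha, b, hb, rfl⟩ := (LieSubmodule.mem_sup _ _ _).1 hv
    have hb' : b ∈ X' := hb
    rw [hX', LieSubmodule.mem_bot] at hb'
    rw [hb', add_zero]
    exact ha
  exact complementedLattice_of_sSup_atoms_eq_top hsoc

end Semisimple

/-! ### Completely solvable algebras -/

section CompletelySolvable

variable {F L : Type*} [Field F] [LieRing L] [LieAlgebra F L]

/-- Subspaces containing the derived algebra contain the Frattini subalgebra. -/
theorem frattini_le_of_lie_mem {H : Submodule F L} (hH : ∀ x y : L, ⁅x, y⁆ ∈ H) :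
    (frattini F L).toSubmodule ≤ H := by
  intro x hx
  by_contra hxH
  -- A hyperplane containing all brackets is a maximal subalgebra.
  obtain ⟨f, hfx, hf⟩ := Submodule.exists_le_ker_of_notMem hxH
  let M : LieSubalgebra F L :=
    { LinearMap.ker f with lie_mem' := fun {y z} _ _ => hf (hH y z) }
  have hM : IsCoatom M := by
    refine ⟨fun h => hfx (?_ : x ∈ M), fun K hK => ?_⟩
    · rw [h]; exact LieSubalgebra.mem_top x
    · obtain ⟨y, hyK, hyM⟩ := Set.exists_of_ssubset hK
      have hy : f y ≠ 0 := hyM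
      rw [eq_top_iff]
      intro z _
      have h1 : z - (f z / f y) • y ∈ M := by
        change f _ = 0
        rw [map_sub, map_smul, smul_eq_mul, div_mul_cancel₀ _ hy, sub_self]
      simpa using add_mem (hK.le h1) (K.smul_mem (f z / f y) hyK)
  exact hfx ((sInf_le hM : frattini F L ≤ M) hx)

variable [FiniteDimensional F L]

theorem wellFoundedLT_lieSubalgebra : WellFoundedLT (LieSubalgebra F L) :=
  RelHomClass.isWellFounded
    (⟨LieSubalgebra.toSubmodule, @fun _ _ h => h⟩ :
      ((· < ·) : LieSubalgebra F L → _ → Prop) →r ((· < ·) : Submodule F L → _ → Prop))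

/-- Abelian ideals split if the Frattini subalgebra is trivial. -/
theorem exists_compl_of_abelian (hφ : frattini F L = ⊥) {A : LieIdeal F L}
    (hA : ∀ a ∈ A, ∀ b ∈ A, ⁅a, b⁆ = 0) :
    ∃ U : LieSubalgebra F L, U ⊔ A.toLieSubalgebra = ⊤ ∧ ∀ x ∈ U, x ∈ A → x = 0 := by
  have hwf := wellFoundedLT_lieSubalgebra (F := F) (L := L)
  -- For a minimal supplement `U` of `A`, the ideal `U ∩ A` lies in every maximal `M`: otherwise `M
  -- ∩ U` would be a smaller supplement.
  obtain ⟨U, hU, hmin⟩ := hwf.wf.has_min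
    {U : LieSubalgebra F L | U ⊔ A.toLieSubalgebra = ⊤} ⟨⊤, top_sup_eq _⟩
  replace hU : U ⊔ A.toLieSubalgebra = ⊤ := hU
  refine ⟨U, hU, fun x hxU hxA => ?_⟩
  obtain ⟨E, hE⟩ := exists_ideal_eq_inf (N := A) hU fun a ha y hy _ => by
    rw [hA a ha y hy]; exact U.zero_mem
  have hEφ : E.toLieSubalgebra ≤ frattini F L := by
    refine le_sInf fun M hM => ?_
    by_contra hEM
    have hEU : E.toLieSubalgebra ≤ U := hE ▸ inf_le_left
    have hEA : E.toLieSubalgebra ≤ A.toLieSubalgebra := hE ▸ inf_le_right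
    have h1 : U ≤ (M ⊓ U) ⊔ E.toLieSubalgebra :=
      le_trans (le_inf (sup_ideal_eq_top hM hEM ▸ le_top) le_rfl) (inf_sup_ideal_le hEU)
    have h2 : (M ⊓ U) ⊔ A.toLieSubalgebra = ⊤ := by
      rw [eq_top_iff, ← hU]
      exact sup_le (h1.trans (sup_le_sup_left hEA _)) le_sup_right
    have h3 : ¬ M ⊓ U < U := hmin _ h2
    have h4 : U ≤ M := by
      by_contra hUM
      exact h3 (inf_lt_right.2 hUM)
    exact hEM (hEU.trans h4)
  have hx : x ∈ E.toLieSubalgebra := by rw [hE]; exact ⟨hxU, hxA⟩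
  have := hEφ hx
  rw [hφ] at this
  exact this

/-- A submodule of `A` is an abelian ideal, so it splits in `L`; the trace on `A` of its complement
is again an ideal. -/
theorem complementedLattice_of_abelian (hφ : frattini F L = ⊥) {A : LieIdeal F L}
    (hA : ∀ a ∈ A, ∀ b ∈ A, ⁅a, b⁆ = 0) : ComplementedLattice (LieSubmodule F L A) := by
  refine ⟨fun X => ?_⟩
  let X₀ : LieIdeal F L := X.map (LieSubmodule.incl A)
  have hX₀ : ∀ x, x ∈ X₀ → ∃ y ∈ X, (y : L) = x := fun x hx => (LieSubmodule.mem_map _).1 hx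
  have hX₀A : X₀ ≤ A := by
    intro x hx
    obtain ⟨y, -, rfl⟩ := hX₀ x hx
    exact y.2
  obtain ⟨U, hU, hU0⟩ := exists_compl_of_abelian hφ (A := X₀)
    fun a ha b hb => hA a (hX₀A ha) b (hX₀A hb)
  obtain ⟨D, hD⟩ := exists_ideal_eq_inf (N := A) hU fun a ha y hy _ => by
    rw [hA a (hX₀A ha) y hy]; exact U.zero_mem
  have hD' : ∀ x, x ∈ D ↔ x ∈ U ∧ x ∈ A := fun x => mem_iff_of_toLieSubalgebra_eq_inf hD
  refine ⟨LieSubmodule.comap (LieSubmodule.incl A) D, ?_⟩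
  rw [isCompl_iff, disjoint_iff, codisjoint_iff, eq_bot_iff, eq_top_iff]
  constructor
  · rintro x ⟨hx, hxD⟩
    have h1 : (x : L) ∈ D := hxD
    have := hU0 x ((hD' _).1 h1).1 (LieSubmodule.mem_map_of_mem (f := LieSubmodule.incl A) hx)
    exact Subtype.ext this
  · intro a _
    obtain ⟨u, hu, x, hx, hux⟩ := mem_sup_ideal.1 (hU ▸ LieSubalgebra.mem_top (R := F) (a : L))
    obtain ⟨y, hy, rfl⟩ := hX₀ x hx
    have huA : u ∈ A := by
      have := sub_mem a.2 y.2
      rwa [← hux, add_sub_cancel_right] at this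
    refine (LieSubmodule.mem_sup _ _ _).2 ⟨y, hy, ⟨u, huA⟩, (hD' u).2 ⟨hu, huA⟩, ?_⟩
    ext
    rw [← hux]
    exact add_comm _ _

/-- If the Frattini subalgebra is trivial and `A` is an abelian ideal that contains the derived
algebra, then every subspace of `A` invariant under a subalgebra `S` has an `S`-invariant
complement in `A`. -/
theorem exists_invariant_compl (hφ : frattini F L = ⊥) {A : LieIdeal F L}
    (hA : ∀ a ∈ A, ∀ b ∈ A, ⁅a, b⁆ = 0) (hLA : ∀ x y : L, ⁅x, y⁆ ∈ A) (S : LieSubalgebra F L)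
    {X : Submodule F L} (hXA : X ≤ A.toSubmodule) (hX : ∀ s ∈ S, ∀ x ∈ X, ⁅s, x⁆ ∈ X) :
    ∃ Y : Submodule F L, Y ≤ A.toSubmodule ∧ (∀ s ∈ S, ∀ y ∈ Y, ⁅s, y⁆ ∈ Y) ∧
      X ⊓ Y = ⊥ ∧ X ⊔ Y = A.toSubmodule := by
  have := complementedLattice_of_abelian hφ hA
  -- The commutator of the two operators is the action of `[x, y] ∈ A`, which kills the abelian
  -- ideal `A`.
  have hcomm : ∀ (x y : L) (a : A), ⁅x, ⁅y, a⁆⁆ = ⁅y, ⁅x, a⁆⁆ := by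
    intro x y a
    rw [leibniz_lie, add_eq_right]
    ext
    exact hA _ (hLA x y) _ a.2
  have := complementedLattice_restrict hcomm S
  let X' : LieSubmodule F S A :=
    { X.comap A.toSubmodule.subtype with lie_mem := fun {s x} hx => hX s s.2 x hx }
  obtain ⟨Y, hY⟩ := exists_isCompl X'
  refine ⟨Y.toSubmodule.map A.toSubmodule.subtype, ?_, ?_, ?_, ?_⟩
  · rintro _ ⟨y, -, rfl⟩
    exact y.2
  · rintro s hs _ ⟨(y : A), hy, rfl⟩
    exact ⟨(⁅(⟨s, hs⟩ : S), (show A from y)⁆ : A), Y.lie_mem hy, rfl⟩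
  · rw [eq_bot_iff]
    rintro _ ⟨hx, ⟨(y : A), hy, rfl⟩⟩
    have h1 : y ∈ X' ⊓ Y := ⟨hx, hy⟩
    rw [hY.inf_eq_bot, LieSubmodule.mem_bot] at h1
    simp [h1]
  · refine le_antisymm (sup_le hXA ?_) fun a ha => ?_
    · rintro _ ⟨y, -, rfl⟩
      exact y.2
    · have h1 : (⟨a, ha⟩ : A) ∈ X' ⊔ Y := hY.sup_eq_top ▸ LieSubmodule.mem_top _
      obtain ⟨x, hx, y, hy, hxy⟩ := (LieSubmodule.mem_sup _ _ _).1 h1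
      have h2 : a = (x : L) + (y : L) := (congrArg Subtype.val hxy).symm
      rw [h2]
      exact Submodule.add_mem_sup hx ⟨y, hy, rfl⟩

variable [LieAlgebra.IsSolvable L]

/-- Semisimplicity of `A` under `S` puts `[S, S]`, hence `φ(S)`, into a part of `A` with no
`S`-trivial vectors. A minimal ideal `W` of `S` inside `φ(S)` is then acted on nontrivially, and is
complemented in `S` by the centraliser of a suitable `s` modulo an invariant complement of `W`. This
contradicts `W ⊆ φ(S)`. -/
theorem isElementary_of_frattini_eq_bot (hφ : frattini F L = ⊥) {A : LieIdeal F L}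
    (hA : ∀ a ∈ A, ∀ b ∈ A, ⁅a, b⁆ = 0) (hLA : ∀ x y : L, ⁅x, y⁆ ∈ A) : IsElementary F L := by
  intro S
  have hsol := isSolvable_subalgebra S
  obtain ⟨P, hP⟩ := exists_ideal_eq_frattini (F := F) (L := S)
  by_contra hS
  -- the `S`-trivial part of `A` and an `S`-invariant complement
  let Z : Submodule F L :=
    { carrier := {a | a ∈ A ∧ ∀ s ∈ S, ⁅s, a⁆ = 0}
      add_mem' := fun ha hb => ⟨add_mem ha.1 hb.1, fun s hs => by
        rw [lie_add, ha.2 s hs, hb.2 s hs, add_zero]⟩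
      zero_mem' := ⟨A.zero_mem, fun s _ => lie_zero s⟩
      smul_mem' := fun c a ha => ⟨A.smul_mem c ha.1, fun s hs => by
        rw [lie_smul, ha.2 s hs, smul_zero]⟩ }
  obtain ⟨Y, hYA, hYS, hZY, hZYA⟩ := exists_invariant_compl hφ hA hLA S (X := Z)
    (fun a ha => ha.1) (fun s hs a ha => by rw [ha.2 s hs]; exact Z.zero_mem)
  have hSA : ∀ s ∈ S, ∀ a ∈ A, ⁅s, a⁆ ∈ Y := by
    intro s hs a ha
    have : a ∈ Z ⊔ Y := hZYA ▸ ha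
    obtain ⟨z, hz, y, hy, rfl⟩ := Submodule.mem_sup.1 this
    rw [lie_add, hz.2 s hs, zero_add]
    exact hYS s hs y hy
  obtain ⟨C, hCtop, hC0⟩ := exists_compl_of_abelian hφ hA
  -- The complement `C` of `A` is abelian, since its brackets lie in `C ∩ A = 0`; so `[s, t]`
  -- involves only brackets of `S` with `A`.
  have hSS : ∀ s ∈ S, ∀ t ∈ S, ⁅s, t⁆ ∈ Y := by
    intro s hs t ht
    obtain ⟨c, hc, a, ha, hca⟩ := mem_sup_ideal.1 (hCtop ▸ LieSubalgebra.mem_top (R := F) s)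
    obtain ⟨d, hd, b, hb, hdb⟩ := mem_sup_ideal.1 (hCtop ▸ LieSubalgebra.mem_top (R := F) t)
    have hcd : ⁅c, d⁆ = 0 := hC0 _ (C.lie_mem hc hd) (hLA c d)
    have hst : ⁅s, t⁆ = ⁅s, b⁆ - ⁅t, a⁆ := by
      rw [← hca, ← hdb]
      simp only [add_lie, lie_add, hcd, hA a ha b hb, hA b hb a ha]
      rw [← lie_skew d a]
      abel
    rw [hst]
    exact sub_mem (hSA s hs b hb) (hSA t ht a ha)
  have hφY : ∀ x : S, x ∈ frattini F S → (x : L) ∈ Y := fun x hx =>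
    frattini_le_of_lie_mem (L := S) (H := Y.comap S.toSubmodule.subtype)
      (fun s t : S => hSS s s.2 t t.2) hx
  -- a minimal ideal `W` of `S` inside the Frattini subalgebra
  have hPne : P ≠ ⊥ := by
    rintro rfl
    exact hS (eq_bot_iff.2 fun x hx => by rw [← hP] at hx; exact hx)
  obtain ⟨W, hW, hWP⟩ := (eq_bot_or_exists_atom_le P).resolve_left hPne
  have hWφ : W.toLieSubalgebra ≤ frattini F S := hP ▸ fun x hx => hWP hx
  have hWY : ∀ w ∈ W, (w : L) ∈ Y := fun w hw => hφY w (hWφ hw)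
  have hWA : ∀ w ∈ W, (w : L) ∈ A := fun w hw => hYA (hWY w hw)
  have hcomm : ∀ (s t w : S), w ∈ W → ⁅s, ⁅t, w⁆⁆ = ⁅t, ⁅s, w⁆⁆ := by
    intro s t w hw
    rw [leibniz_lie, add_eq_right]
    ext
    exact hA _ (hLA s t) _ (hWA w hw)
  obtain ⟨s, w₀, hw₀, hsw₀⟩ : ∃ (s w : S), w ∈ W ∧ ⁅s, w⁆ ≠ 0 := by
    by_contra! hcon
    refine hW.1 (eq_bot_iff.2 fun w hw => ?_)
    have h1 : (w : L) ∈ Z ⊓ Y := ⟨⟨hWA w hw, fun s hs =>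
      congrArg Subtype.val (hcon ⟨s, hs⟩ w hw)⟩, hWY w hw⟩
    rw [hZY, Submodule.mem_bot] at h1
    exact Subtype.ext h1
  -- Schur's argument: kernel and image of `ad s` on `W` are ideals of `S`, so `ad s` is bijective
  -- on the minimal ideal `W`.
  have hinj : ∀ w ∈ W, ⁅s, w⁆ = 0 → w = 0 := by
    let K : LieIdeal F S :=
      { carrier := {w | w ∈ W ∧ ⁅s, w⁆ = 0}
        add_mem' := fun ha hb => ⟨add_mem ha.1 hb.1, by rw [lie_add, ha.2, hb.2, add_zero]⟩
        zero_mem' := ⟨W.zero_mem, lie_zero s⟩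
        smul_mem' := fun c a ha => ⟨W.smul_mem c ha.1, by rw [lie_smul, ha.2, smul_zero]⟩
        lie_mem := fun {t w} hw => ⟨lie_mem_right F S W _ _ hw.1, by
          rw [hcomm s t w hw.1, hw.2, lie_zero]⟩ }
    intro w hw hsw
    rcases hW.le_iff.1 (fun x hx => hx.1 : K ≤ W) with h | h
    · have : w ∈ K := ⟨hw, hsw⟩
      rwa [h, LieSubmodule.mem_bot] at this
    · exact absurd (h.symm ▸ hw₀ : w₀ ∈ K).2 hsw₀
  have hsurj : ∀ w ∈ W, ∃ u ∈ W, ⁅s, u⁆ = w := by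
    let K : LieIdeal F S :=
      { W.toSubmodule.map (LieModule.toEnd F S S s) with
        lie_mem := by
          rintro t _ ⟨u, hu, rfl⟩
          exact ⟨⁅t, u⁆, lie_mem_right F S W _ _ hu, hcomm s t u hu⟩ }
    have hKW : K ≤ W := by
      rintro _ ⟨u, hu, rfl⟩
      exact lie_mem_right F S W _ _ hu
    rcases hW.le_iff.1 hKW with h | h
    · have : ⁅s, w₀⁆ ∈ K := ⟨w₀, hw₀, rfl⟩
      rw [h, LieSubmodule.mem_bot] at this
      exact absurd this hsw₀
    · intro w hw
      exact (h.symm ▸ hw : w ∈ K)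
  -- an `S`-invariant complement `X` of `W` in `A`, and the centraliser of `s` modulo `X`
  obtain ⟨X, -, hXS, hWX, hWXA⟩ := exists_invariant_compl hφ hA hLA S
    (X := W.toSubmodule.map S.toSubmodule.subtype)
    (by rintro _ ⟨w, hw, rfl⟩; exact hWA w hw)
    (by
      rintro t ht _ ⟨(w : S), hw, rfl⟩
      exact ⟨⁅(⟨t, ht⟩ : S), w⁆, lie_mem_right F S W _ _ hw, rfl⟩)
  let M : LieSubalgebra F S :=
    { X.comap (S.toSubmodule.subtype ∘ₗ LieModule.toEnd F S S s) with
      lie_mem' := by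
        intro y z hy hz
        have hy' : ⁅(s : L), (y : L)⁆ ∈ X := hy
        have hz' : ⁅(s : L), (z : L)⁆ ∈ X := hz
        change ⁅(s : L), ⁅(y : L), (z : L)⁆⁆ ∈ X
        rw [leibniz_lie, ← lie_skew]
        exact add_mem (neg_mem (hXS z z.2 _ hy')) (hXS y y.2 _ hz') }
  have hM : ∀ y : S, y ∈ M ↔ ⁅(s : L), (y : L)⁆ ∈ X := fun y => Iff.rfl
  have hMW : ∀ w ∈ W, w ∈ M → w = 0 := by
    intro w hw hwM
    refine hinj w hw (Subtype.ext ?_)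
    have h1 : ⁅(s : L), (w : L)⁆ ∈ W.toSubmodule.map S.toSubmodule.subtype ⊓ X :=
      ⟨⟨⁅s, w⁆, lie_mem_right F S W _ _ hw, rfl⟩, (hM w).1 hwM⟩
    rwa [hWX, Submodule.mem_bot] at h1
  have hMtop : M ⊔ W.toLieSubalgebra = ⊤ := by
    rw [eq_top_iff]
    intro y _
    have h1 : ⁅(s : L), (y : L)⁆ ∈ W.toSubmodule.map S.toSubmodule.subtype ⊔ X :=
      hWXA ▸ hLA _ _
    obtain ⟨_, ⟨w, hw, rfl⟩, x, hx, hxy⟩ := Submodule.mem_sup.1 h1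
    obtain ⟨u, hu, rfl⟩ := hsurj w hw
    -- Here `[s, u]` is the `W`-component of `[s, y]`, so subtracting `u` leaves only the
    -- `X`-component.
    refine mem_sup_ideal.2 ⟨y - u, (hM _).2 ?_, u, hu, sub_add_cancel y u⟩
    have h2 : ⁅(s : L), ((y - u : S) : L)⁆ = x := by
      change ⁅(s : L), (y : L) - (u : L)⁆ = x
      rw [lie_sub, ← hxy]
      exact add_sub_cancel_left _ _
    rwa [h2]
  rcases eq_top_or_exists_le_coatom M with h | ⟨K, hK, hMK⟩
  · exact hsw₀ (by rw [hMW w₀ hw₀ (h ▸ LieSubalgebra.mem_top w₀), lie_zero])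
  · exact hK.1 (top_le_iff.1 (hMtop.symm.le.trans
      (sup_le hMK (hWφ.trans (sInf_le hK)))))

/-- Nilpotency of `L²` gives `[L², L²] ⊆ φ(L)`, so the image of `L²` is an abelian ideal containing
the derived algebra of the quotient. -/
theorem isElementary_quotient_of_isCompletelySolvable (h : IsCompletelySolvable F L)
    {P : LieIdeal F L} (hP : P.toLieSubalgebra = frattini F L) : IsElementary F (L ⧸ P) := by
  have hsol := isSolvable_quotient P
  set D := LieAlgebra.derivedSeries F L 1 with hD
  have hDD : ⁅D, D⁆ ≤ P := fun x hx => by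
    have := lie_self_le_frattini h hx
    rw [← hP] at this
    exact this
  have hφ : frattini F (L ⧸ P) = ⊥ := by
    rw [eq_bot_iff]
    intro y hy
    obtain ⟨x, rfl⟩ := quotientHom_surjective P y
    have h1 := comap_frattini_le (quotientHom_surjective P) hy
    rw [ker_quotientHom] at h1
    have h2 : x ∈ frattini F L := by
      refine (le_sInf fun M hM => ?_ : frattiniOver P ≤ frattini F L) h1
      exact frattiniOver_le hM (hP ▸ sInf_le hM)
    rw [← hP] at h2
    exact LieSubmodule.Quotient.mk_eq_zero'.2 h2
  refine isElementary_of_frattini_eq_bot hφ (A := D.map (quotientHom P)) ?_ ?_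
  · intro a ha b hb
    obtain ⟨x, rfl⟩ := LieIdeal.mem_map_of_surjective (quotientHom_surjective P) ha
    obtain ⟨y, rfl⟩ := LieIdeal.mem_map_of_surjective (quotientHom_surjective P) hb
    rw [← LieHom.map_lie]
    exact LieSubmodule.Quotient.mk_eq_zero'.2 (hDD (LieSubmodule.lie_mem_lie x.2 y.2))
  · intro x y
    obtain ⟨x, rfl⟩ := quotientHom_surjective P x
    obtain ⟨y, rfl⟩ := quotientHom_surjective P y
    rw [← LieHom.map_lie]
    refine LieIdeal.mem_map ?_
    exact LieSubmodule.lie_mem_lie (LieSubmodule.mem_top x) (LieSubmodule.mem_top y)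

theorem IsCompletelySolvable.residuals_eq (h : IsCompletelySolvable F L) :
    frattini F L = (prefrattiniResidual F L).toLieSubalgebra ∧
      prefrattiniResidual F L = elementaryCommutator F L := by
  obtain ⟨P, hP⟩ := exists_ideal_eq_frattini (F := F) (L := L)
  have hE : elementaryCommutator F L ≤ P :=
    sInf_le ⟨isSolvable_quotient P, isElementary_quotient_of_isCompletelySolvable h hP⟩
  have hφ := frattini_le_prefrattiniResidual (F := F) (L := L)
  have hle := prefrattiniResidual_le_elementaryCommutator (F := F) (L := L)
  rw [← hP] at hφ ⊢
  exact ⟨le_antisymm hφ fun x hx => hE (hle hx), le_antisymm hle fun x hx => hφ (hE hx)⟩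

end CompletelySolvable

end SolvLie

theorem proposition2p6 {F L : Type*} [Field F] [LieRing L] [LieAlgebra F L]
    [FiniteDimensional F L] [LieAlgebra.IsSolvable L] :
    -- (i)
    (SolvLie.frattini F L ≤ (SolvLie.prefrattiniResidual F L).toLieSubalgebra ∧
      SolvLie.prefrattiniResidual F L ≤ SolvLie.elementaryCommutator F L ∧
      (SolvLie.IsCompletelySolvable F L →
        SolvLie.frattini F L = (SolvLie.prefrattiniResidual F L).toLieSubalgebra ∧
        SolvLie.prefrattiniResidual F L = SolvLie.elementaryCommutator F L)) ∧
    -- (ii)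
    ((∀ A : LieIdeal F L,
        (SolvLie.prefrattiniResidual F (L ⧸ A)).toSubmodule =
          (SolvLie.prefrattiniResidual F L ⊔ A).toSubmodule.map
            (LieSubmodule.Quotient.mk' A : L →ₗ[F] L ⧸ A)) ∧
      -- the Frattini subalgebra is an ideal `P`, and `π(L / P) = π(L) / P`
      (∃ P : LieIdeal F L, P.toLieSubalgebra = SolvLie.frattini F L ∧
        (SolvLie.prefrattiniResidual F (L ⧸ P)).toSubmodule =
          (SolvLie.prefrattiniResidual F L).toSubmodule.map
            (LieSubmodule.Quotient.mk' P : L →ₗ[F] L ⧸ P))) ∧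
    -- (iii)
    (LieRing.IsNilpotent (SolvLie.prefrattiniResidual F L) ↔
      (SolvLie.prefrattiniResidual F L).toLieSubalgebra = SolvLie.frattini F L) ∧
    -- (iv)
    (∀ B : LieSubalgebra F L, SolvLie.IsPrefrattini B →
      (SolvLie.prefrattiniResidual F L).toSubmodule =
        B.toSubmodule ⊔
          (SolvLie.nilpotentResidual F (SolvLie.prefrattiniResidual F L)).toSubmodule.map
            (SolvLie.prefrattiniResidual F L).toSubmodule.subtype) := by
  refine ⟨⟨SolvLie.frattini_le_prefrattiniResidual,
    SolvLie.prefrattiniResidual_le_elementaryCommutator, fun h => h.residuals_eq⟩,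
    ⟨SolvLie.prefrattiniResidual_quotient, ?_⟩, SolvLie.isNilpotent_prefrattiniResidual_iff,
    fun B hB => hB.prefrattiniResidual_eq⟩
  obtain ⟨P, hP⟩ := SolvLie.exists_ideal_eq_frattini (F := F) (L := L)
  refine ⟨P, hP, ?_⟩
  have hle : P ≤ SolvLie.prefrattiniResidual F L := fun x hx =>
    SolvLie.frattini_le_prefrattiniResidual (hP ▸ hx : x ∈ SolvLie.frattini F L)
  rw [SolvLie.prefrattiniResidual_quotient, sup_eq_left.2 hle]
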